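/- Let $f:\mathbb R\to\mathbb C$ be $2\pi$-periodic and integrable over a period, and write $\|g\|=\int_{-\pi}^{\pi}|g(x)|\,dx$, $\hat f(k)=\frac1{2\pi}\int_{-\pi}^{\pi}f(x)e^{-ikx}\,dx$ for $k\in\mathbb Z$, and $S_n(f,x)=\sum_{k=-n}^{n}\hat f(k)e^{ikx}$. A complex sequence $\mathbf c=\{c_n\}_{n\ge 1}$ belongs to the class $\mathrm{GBV}$ if there is $\theta\in[0,\pi/2)$ with $|\arg c_n|\le\theta$ for all $n\ge1$ (the value $c_n=0$ being allowed), and there are an integer $N_0\ge 1$ and a constant $M>0$ such that $$\sum_{n=m}^{2m}|c_n-c_{n+1}|\le M\max_{m\le n<m+N_0}|c_n|\qquad\text{for all } m=1,2,\dots$$ Suppose that both $\{\hat f(n)\}_{n\ge1}$ and $\{\hat f(-n)\}_{n\ge 1}$ belong to $\mathrm{GBV}$. Let $r\ge1$ be an integer and suppose that $f,f',\dots,f^{(r-1)}$ are absolutely continuous on every compact interval (so that $f^{(r)}$ exists almost everywhere and is integrable over a period). Then $$\|f-S_n(f)\|=O\left((n+1)^{-r}\,\omega\left(f^{(r)},(n+1)^{-1}\right)_L\right)\qquad(n=0,1,2,\dots)$$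 if and only if $$\hat f(n)\log|n|=O\left((|n|+1)^{-r}\,\omega\left(f^{(r)},(|n|+1)^{-1}\right)_L\right)\qquad(n\in\mathbb Z,\ n\ne0),$$ where $\omega(g,t)_L=\sup_{0\le h\le t}\|g(\cdot+h)-g\|$ is the integral modulus of continuity, and each $O$ means an inequality between absolute values with a positive constant factor that does not depend on $n$. -/

import Mathlib

open MeasureTheory

/-- The space `L_{2π}`: complex-valued functions on `ℝ` of period `2π`, integrable over a period. -/
def IsL2Pi (f : ℝ → ℂ) : Prop :=
  Function.Periodic f (2 * Real.pi) ∧ IntervalIntegrable f volume (-Real.pi) Real.pi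

/-- The norm `‖g‖ = ∫_{-π}^{π} |g(x)| dx`. -/
noncomputable def normL (g : ℝ → ℂ) : ℝ :=
  ∫ x in (-Real.pi)..Real.pi, ‖g x‖

/-- The Fourier coefficient `(1 / 2π) ∫_{-π}^{π} f(x) e^{-inx} dx`. -/
noncomputable def fhat (f : ℝ → ℂ) (n : ℤ) : ℂ :=
  fourierCoeffOn (neg_lt_self Real.pi_pos) f n

/-- The symmetric partial sum `S_n(f, x) = ∑_{k=-n}^{n} f̂(k) e^{ikx}`. -/
noncomputable def partialSum (f : ℝ → ℂ) (n : ℕ) (x : ℝ) : ℂ :=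
  ∑ k ∈ Finset.Icc (-(n : ℤ)) (n : ℤ), fhat f k * Complex.exp (Complex.I * (k : ℂ) * (x : ℂ))

/-- The sector `K(θ) = {z : |arg z| ≤ θ}`; it contains `0`, since `Complex.arg 0 = 0`. -/
def sectorK (θ : ℝ) : Set ℂ := {z | |Complex.arg z| ≤ θ}

/-- The class GBV of sequences `c 1, c 2, …` (the entry `c 0` is not used). -/
def IsGBV (c : ℕ → ℂ) : Prop :=
  (∃ θ : ℝ, 0 ≤ θ ∧ θ < Real.pi / 2 ∧ ∀ n : ℕ, 1 ≤ n → c n ∈ sectorK θ) ∧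
  ∃ N₀ : ℕ, 1 ≤ N₀ ∧ ∃ M : ℝ, 0 < M ∧ ∀ m : ℕ, 1 ≤ m →
    ∑ n ∈ Finset.Icc m (2 * m), ‖c n - c (n + 1)‖ ≤
      M * (((Finset.Ico m (m + N₀)).sup fun n => ‖c n‖₊ : NNReal) : ℝ)

/-- The integral modulus of continuity `ω(g, t)_L = sup_{0 ≤ h ≤ t} ‖g(· + h) - g‖`. -/
noncomputable def modulusL (g : ℝ → ℂ) (t : ℝ) : ℝ :=
  ⨆ h : Set.Icc (0 : ℝ) t, normL fun x => g (x + (h : ℝ)) - g x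

/-- `g` is absolutely continuous on every compact interval. -/
def IsLocallyAC (g : ℝ → ℂ) : Prop :=
  ∀ a b : ℝ, AbsolutelyContinuousOnInterval g a b

/-! ### Absolutely continuous functions are integrals of their derivatives -/

/-! Write ψ(n) = (n+1)^{-r} ω(f^{(r)}, 1/(n+1)), the `jacksonRate`. It decreases, and ψ(m) ≤ 2^{r+1}
ψ(N) whenever N ≤ 2m+1.

From approximation to coefficients: f - S_n has no frequency in [-n, n]. Pairing it with e^{-inx}
Σ_{k≤2n} sin(kx)/k, a function bounded uniformly in n and x, therefore leaves only a constant times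
Σ_{k≤2n} f̂(n+k)/k (`norm_sum_fhat_div_le`). The sector condition rules out cancellation, so Σ
|f̂(n+k)|/k = O(ψ(n)). Take n = ⌊N/2⌋: by bounded variation |f̂(N)| is dominated by a short window
of coefficients starting at each n+k with k ≤ n, and the weights 1/k add up to a multiple of log N
(`norm_mul_log_le_sum`). Negative frequencies follow by applying this to f(-x).

From coefficients to approximation: f is compared with its de la Vallée Poussin mean V_n. These
means are bounded in L¹ and reproduce trigonometric polynomials of degree n, so Jackson's theorem in
L¹ (`exists_trigPoly_normL_sub_le`) gives ‖f - V_n‖ = O(ψ(n)). The difference V_n - S_n is an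
average of blocks of the Fourier series lying just outside [-n, n], of length less than n. Summation
by parts against the Dirichlet kernel bounds the L¹ norm of a block by log(n+1) times the last
coefficient plus the variation of the coefficients. Bounded variation reduces this to log(n+1) times
a window of N₀ coefficients, which is O(ψ(n)) by hypothesis (`IsGBV.normL_expBlock_le`). -/

theorem AbsolutelyContinuousOnInterval.comp_lipschitzWith {X Y : Type*} [PseudoMetricSpace X]
    [PseudoMetricSpace Y] {K : NNReal} {φ : X → Y} (hφ : LipschitzWith K φ) {f : ℝ → X} {a b : ℝ}
    (hf : AbsolutelyContinuousOnInterval f a b) :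
    AbsolutelyContinuousOnInterval (fun x => φ (f x)) a b := by
  unfold AbsolutelyContinuousOnInterval at hf ⊢
  refine squeeze_zero (fun E => Finset.sum_nonneg fun i _ => dist_nonneg) (fun E => ?_)
    (by simpa using hf.const_mul (K : ℝ))
  rw [Finset.mul_sum]
  exact Finset.sum_le_sum fun i _ => hφ.dist_le_mul _ _

theorem AbsolutelyContinuousOnInterval.deriv_complex {f : ℝ → ℂ} {a b : ℝ}
    (hf : AbsolutelyContinuousOnInterval f a b) :
    IntervalIntegrable (deriv f) volume a b ∧ ∫ x in a..b, deriv f x = f b - f a := by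
  -- The fundamental theorem of calculus is applied to the real and imaginary parts separately.
  have hre := hf.comp_lipschitzWith Complex.reCLM.lipschitz
  have him := hf.comp_lipschitzWith Complex.imCLM.lipschitz
  have hae : ∀ᵐ x, x ∈ Set.uIcc a b →
      deriv f x = ((deriv (fun x => Complex.reCLM (f x)) x : ℝ) : ℂ)
        + ((deriv (fun x => Complex.imCLM (f x)) x : ℝ) : ℂ) * Complex.I := by
    filter_upwards [hf.boundedVariationOn.ae_differentiableAt_of_mem_uIcc] with x hx hxm
    have h := (hx hxm).hasDerivAt
    have h1 := (Complex.reCLM.hasFDerivAt.comp_hasDerivAt x h).deriv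
    have h2 := (Complex.imCLM.hasFDerivAt.comp_hasDerivAt x h).deriv
    simp only [Function.comp_def] at h1 h2
    rw [h1, h2]
    simp [Complex.re_add_im]
  have hae' : ∀ᵐ x, x ∈ Set.uIoc a b →
      deriv f x = ((deriv (fun x => Complex.reCLM (f x)) x : ℝ) : ℂ)
        + ((deriv (fun x => Complex.imCLM (f x)) x : ℝ) : ℂ) * Complex.I := by
    filter_upwards [hae] with x hx hm using hx (Set.uIoc_subset_uIcc hm)
  have i1 : IntervalIntegrable (fun x => ((deriv (fun x => Complex.reCLM (f x)) x : ℝ) : ℂ)) volume a b :=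
    ⟨hre.intervalIntegrable_deriv.1.ofReal, hre.intervalIntegrable_deriv.2.ofReal⟩
  have i2 : IntervalIntegrable
      (fun x => ((deriv (fun x => Complex.imCLM (f x)) x : ℝ) : ℂ) * Complex.I) volume a b :=
    IntervalIntegrable.mul_const (f := fun x => ((deriv (fun x => Complex.imCLM (f x)) x : ℝ) : ℂ))
      ⟨him.intervalIntegrable_deriv.1.ofReal, him.intervalIntegrable_deriv.2.ofReal⟩ _
  refine ⟨(i1.add i2).congr_ae ?_, ?_⟩
  · rw [Filter.EventuallyEq, ae_restrict_iff' measurableSet_uIoc]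
    filter_upwards [hae'] with x hx hm using (hx hm).symm
  · rw [intervalIntegral.integral_congr_ae hae', intervalIntegral.integral_add i1 i2,
      intervalIntegral.integral_mul_const, intervalIntegral.integral_ofReal,
      intervalIntegral.integral_ofReal, hre.integral_deriv_eq_sub, him.integral_deriv_eq_sub]
    apply Complex.ext <;> simp

/-! ### Periodic integrable functions and their `L¹` norm -/

/-- Measurable functions of period `2π` that are integrable on every compact interval. -/
structure PerInt (g : ℝ → ℂ) : Prop where
  periodic : Function.Periodic g (2 * Real.pi)
  measurable : Measurable g
  integrable : ∀ a b : ℝ, IntervalIntegrable g volume a b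

namespace PerInt

variable {g h : ℝ → ℂ}

theorem of_continuous (hp : Function.Periodic g (2 * Real.pi)) (hg : Continuous g) : PerInt g :=
  ⟨hp, hg.measurable, fun a b => hg.intervalIntegrable a b⟩

theorem add (hg : PerInt g) (hh : PerInt h) : PerInt (fun x => g x + h x) :=
  ⟨fun x => by simp only [hg.periodic x, hh.periodic x], hg.measurable.add hh.measurable,
    fun a b => (hg.integrable a b).add (hh.integrable a b)⟩

theorem sub (hg : PerInt g) (hh : PerInt h) : PerInt (fun x => g x - h x) :=
  ⟨fun x => by simp only [hg.periodic x, hh.periodic x], hg.measurable.sub hh.measurable,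
    fun a b => (hg.integrable a b).sub (hh.integrable a b)⟩

theorem comp_add (hg : PerInt g) (t : ℝ) : PerInt (fun x => g (x + t)) :=
  ⟨fun x => by rw [add_right_comm, hg.periodic], hg.measurable.comp (measurable_id.add_const t),
    fun a b => by simpa using (hg.integrable (a + t) (b + t)).comp_add_right t⟩

theorem comp_neg (hg : PerInt g) : PerInt (fun x => g (-x)) :=
  ⟨fun x => by rw [neg_add, ← sub_eq_add_neg, hg.periodic.sub_eq], hg.measurable.comp measurable_neg,
    fun a b => (IntervalIntegrable.iff_comp_neg (f := fun x => g (-x))).2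
      (by simpa using hg.integrable (-a) (-b))⟩

theorem mul_continuous (hg : PerInt g) (hp : Function.Periodic h (2 * Real.pi))
    (hh : Continuous h) : PerInt (fun x => g x * h x) :=
  ⟨fun x => by simp only [hg.periodic x, hp x], hg.measurable.mul hh.measurable,
    fun a b => (hg.integrable a b).mul_continuousOn hh.continuousOn⟩

end PerInt

theorem neg_pi_le_pi : -Real.pi ≤ Real.pi := by linarith [Real.pi_pos]

theorem normL_nonneg (g : ℝ → ℂ) : 0 ≤ normL g :=
  intervalIntegral.integral_nonneg neg_pi_le_pi fun _ _ => norm_nonneg _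

theorem normL_add_le {g h : ℝ → ℂ} (hg : PerInt g) (hh : PerInt h) :
    normL (fun x => g x + h x) ≤ normL g + normL h := by
  unfold normL
  rw [← intervalIntegral.integral_add (hg.integrable _ _).norm (hh.integrable _ _).norm]
  exact intervalIntegral.integral_mono_on neg_pi_le_pi ((hg.add hh).integrable _ _).norm
    ((hg.integrable _ _).norm.add (hh.integrable _ _).norm) fun x _ => norm_add_le _ _

theorem normL_sub_le {g h : ℝ → ℂ} (hg : PerInt g) (hh : PerInt h) :
    normL (fun x => g x - h x) ≤ normL g + normL h := by
  unfold normL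
  rw [← intervalIntegral.integral_add (hg.integrable _ _).norm (hh.integrable _ _).norm]
  exact intervalIntegral.integral_mono_on neg_pi_le_pi ((hg.sub hh).integrable _ _).norm
    ((hg.integrable _ _).norm.add (hh.integrable _ _).norm) fun x _ => norm_sub_le _ _

theorem Function.Periodic.integral_comp_add_period {E : Type*} [NormedAddCommGroup E]
    [NormedSpace ℝ E] {g : ℝ → E} (hg : Function.Periodic g (2 * Real.pi)) (t : ℝ) :
    ∫ x in (-Real.pi)..Real.pi, g (x + t) = ∫ x in (-Real.pi)..Real.pi, g x := by
  rw [intervalIntegral.integral_comp_add_right]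
  have h := hg.intervalIntegral_add_eq (-Real.pi + t) (-Real.pi)
  convert h using 2 <;> ring

theorem normL_comp_add {g : ℝ → ℂ} (hg : Function.Periodic g (2 * Real.pi)) (t : ℝ) :
    normL (fun x => g (x + t)) = normL g :=
  Function.Periodic.integral_comp_add_period (g := fun x => ‖g x‖)
    (fun x => by simp only [hg x]) t

theorem normL_comp_neg (g : ℝ → ℂ) : normL (fun x => g (-x)) = normL g := by
  unfold normL
  rw [intervalIntegral.integral_comp_neg fun x => ‖g x‖, neg_neg]

/-! ### The modulus of continuity -/

theorem bddAbove_normL_translate_sub {g : ℝ → ℂ} (hg : PerInt g) (t : ℝ) :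
    BddAbove (Set.range fun h : Set.Icc (0 : ℝ) t => normL fun x => g (x + (h : ℝ)) - g x) := by
  refine ⟨normL g + normL g, ?_⟩
  rintro _ ⟨h, rfl⟩
  refine (normL_sub_le (hg.comp_add h) hg).trans_eq ?_
  rw [normL_comp_add hg.periodic]

theorem normL_translate_sub_le_modulusL {g : ℝ → ℂ} (hg : PerInt g) {h t : ℝ} (h0 : 0 ≤ h)
    (ht : h ≤ t) : normL (fun x => g (x + h) - g x) ≤ modulusL g t :=
  le_ciSup (bddAbove_normL_translate_sub hg t) (⟨h, h0, ht⟩ : Set.Icc (0 : ℝ) t)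

theorem modulusL_nonneg (g : ℝ → ℂ) (t : ℝ) : 0 ≤ modulusL g t :=
  Real.iSup_nonneg fun _ => normL_nonneg _

theorem modulusL_le {g : ℝ → ℂ} {t C : ℝ} (hC : 0 ≤ C)
    (h : ∀ s, 0 ≤ s → s ≤ t → normL (fun x => g (x + s) - g x) ≤ C) : modulusL g t ≤ C :=
  Real.iSup_le (fun s => h s s.2.1 s.2.2) hC

theorem modulusL_mono {g : ℝ → ℂ} (hg : PerInt g) {s t : ℝ} (hst : s ≤ t) :
    modulusL g s ≤ modulusL g t :=
  modulusL_le (modulusL_nonneg _ _) fun _ h0 h1 =>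
    normL_translate_sub_le_modulusL hg h0 (h1.trans hst)

theorem normL_translate_nat_mul_sub_le {g : ℝ → ℂ} (hg : PerInt g) (s : ℝ) (N : ℕ) :
    normL (fun x => g (x + N * s) - g x) ≤ N * normL (fun x => g (x + s) - g x) := by
  induction N with
  | zero => simp [normL]
  | succ N ih =>
    have h1 : (fun x => g (x + (N + 1 : ℕ) * s) - g x) = fun x =>
        (g (x + N * s + s) - g (x + N * s)) + (g (x + N * s) - g x) := by
      funext x
      rw [sub_add_sub_cancel]
      congr 2
      push_cast
      ring
    have hd := (hg.comp_add s).sub hg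
    rw [h1]
    refine (normL_add_le (hd.comp_add (N * s)) ((hg.comp_add _).sub hg)).trans ?_
    rw [normL_comp_add hd.periodic (N * s)]
    push_cast
    linarith

theorem modulusL_nat_mul_le {g : ℝ → ℂ} (hg : PerInt g) (t : ℝ) (N : ℕ) :
    modulusL g (N * t) ≤ N * modulusL g t := by
  refine modulusL_le (mul_nonneg N.cast_nonneg (modulusL_nonneg _ _)) fun s h0 h1 => ?_
  rcases N.eq_zero_or_pos with rfl | hN
  · have : s = 0 := le_antisymm (by simpa using h1) h0
    simp [this, normL]
  have hN' : (0 : ℝ) < N := by exact_mod_cast hN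
  have h := normL_translate_nat_mul_sub_le hg (s / N) N
  rw [mul_div_cancel₀ _ hN'.ne'] at h
  refine h.trans (mul_le_mul_of_nonneg_left ?_ hN'.le)
  exact normL_translate_sub_le_modulusL hg (by positivity) (by rwa [div_le_iff₀' hN'])

/-- A shift by s ≥ 0 is covered by ⌈ms⌉ ≤ 1 + ms shifts of length at most 1/m; a negative shift
reduces to a positive one by translation invariance of the norm. -/
theorem normL_translate_sub_le {g : ℝ → ℂ} (hg : PerInt g) {m : ℕ} (hm : 1 ≤ m) (t : ℝ) :
    normL (fun x => g (x + t) - g x) ≤ (1 + m * |t|) * modulusL g ((m : ℝ)⁻¹) := by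
  have hm' : (0 : ℝ) < m := by exact_mod_cast hm
  have key : ∀ s : ℝ, 0 ≤ s →
      normL (fun x => g (x + s) - g x) ≤ (1 + m * s) * modulusL g ((m : ℝ)⁻¹) := fun s hs => by
    have hc := Nat.ceil_lt_add_one (mul_nonneg hm'.le hs)
    have hle := Nat.le_ceil ((m : ℝ) * s)
    have h1 : s ≤ ⌈(m : ℝ) * s⌉₊ * (m : ℝ)⁻¹ := by
      rw [← div_eq_mul_inv, le_div_iff₀' hm']
      exact hle
    refine (normL_translate_sub_le_modulusL hg hs h1).trans
      ((modulusL_nat_mul_le hg _ _).trans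
        (mul_le_mul_of_nonneg_right (by linarith) (modulusL_nonneg _ _)))
  rcases le_total 0 t with ht | ht
  · rw [abs_of_nonneg ht]
    exact key t ht
  · rw [abs_of_nonpos ht]
    refine le_trans (le_of_eq ?_) (key (-t) (by linarith))
    rw [← normL_comp_add (((hg.comp_add (-t)).sub hg).periodic) t]
    simp only [normL, add_neg_cancel_right]
    simp_rw [norm_sub_rev]

/-! ### Exponentials and Fourier coefficients -/

/-- The exponential `x ↦ e^{ikx}`. -/
noncomputable def expZ (k : ℤ) (x : ℝ) : ℂ := Complex.exp (Complex.I * (k : ℂ) * (x : ℂ))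

theorem continuous_expZ (k : ℤ) : Continuous (expZ k) := by
  unfold expZ
  fun_prop

theorem expZ_zero (x : ℝ) : expZ 0 x = 1 := by simp [expZ]

theorem expZ_add (k l : ℤ) (x : ℝ) : expZ (k + l) x = expZ k x * expZ l x := by
  simp only [expZ, ← Complex.exp_add]
  congr 1
  push_cast
  ring

theorem expZ_apply_add (k : ℤ) (x y : ℝ) : expZ k (x + y) = expZ k x * expZ k y := by
  simp only [expZ, ← Complex.exp_add]
  congr 1
  push_cast
  ring

theorem expZ_apply_neg (k : ℤ) (x : ℝ) : expZ k (-x) = expZ (-k) x := by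
  simp only [expZ]
  congr 1
  push_cast
  ring

theorem expZ_eq_exp_mul_I (k : ℤ) (x : ℝ) :
    expZ k x = Complex.exp (((k * x : ℝ) : ℂ) * Complex.I) := by
  unfold expZ
  congr 1
  push_cast
  ring

theorem norm_expZ (k : ℤ) (x : ℝ) : ‖expZ k x‖ = 1 := by
  rw [expZ_eq_exp_mul_I, Complex.norm_exp_ofReal_mul_I]

theorem conj_expZ (k : ℤ) (x : ℝ) : (starRingEnd ℂ) (expZ k x) = expZ (-k) x := by
  simp only [expZ, ← Complex.exp_conj, map_mul, Complex.conj_I, Complex.conj_ofReal, map_intCast]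
  congr 1
  push_cast
  ring

theorem expZ_periodic (k : ℤ) : Function.Periodic (expZ k) (2 * Real.pi) := fun x => by
  rw [expZ_apply_add]
  have : expZ k (2 * Real.pi) = 1 := by
    rw [expZ, Complex.exp_eq_one_iff]
    exact ⟨k, by push_cast; ring⟩
  rw [this, mul_one]

theorem perInt_expZ (k : ℤ) : PerInt (expZ k) :=
  PerInt.of_continuous (expZ_periodic k) (continuous_expZ k)

theorem hasDerivAt_expZ (k : ℤ) (x : ℝ) :
    HasDerivAt (expZ k) (Complex.I * k * expZ k x) x := by
  have h : HasDerivAt (fun y : ℝ => Complex.I * (k : ℂ) * (y : ℂ)) (Complex.I * k) x := by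
    simpa using (Complex.ofRealCLM.hasDerivAt (x := x)).const_mul (Complex.I * (k : ℂ))
  have h' := h.cexp
  rw [mul_comm (Complex.exp _)] at h'
  exact h'

theorem integral_expZ (k : ℤ) :
    ∫ x in (-Real.pi)..Real.pi, expZ k x = if k = 0 then 2 * (Real.pi : ℂ) else 0 := by
  split_ifs with hk
  · subst hk
    simp only [expZ_zero, intervalIntegral.integral_const, sub_neg_eq_add]
    simp [two_mul]
  · have hk' : Complex.I * (k : ℂ) ≠ 0 := mul_ne_zero Complex.I_ne_zero (by exact_mod_cast hk)
    have h : ∀ x ∈ Set.uIcc (-Real.pi) Real.pi,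
        HasDerivAt (fun x => (Complex.I * (k : ℂ))⁻¹ * expZ k x) (expZ k x) x := fun x _ => by
      have := (hasDerivAt_expZ k x).const_mul (Complex.I * (k : ℂ))⁻¹
      rwa [inv_mul_cancel_left₀ hk'] at this
    rw [intervalIntegral.integral_eq_sub_of_hasDerivAt h ((perInt_expZ k).integrable _ _)]
    have hp := expZ_periodic k (-Real.pi)
    rw [show -Real.pi + 2 * Real.pi = Real.pi by ring] at hp
    rw [hp, sub_self]

theorem fhat_eq (f : ℝ → ℂ) (n : ℤ) :
    fhat f n = (2 * (Real.pi : ℂ))⁻¹ * ∫ x in (-Real.pi)..Real.pi, f x * expZ (-n) x := by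
  rw [fhat, fourierCoeffOn_eq_integral]
  rw [Complex.real_smul]
  congr 1
  · push_cast
    rw [one_div, sub_neg_eq_add, two_mul]
  · refine intervalIntegral.integral_congr fun x _ => ?_
    simp only [fourier_coe_apply, smul_eq_mul]
    rw [mul_comm, expZ]
    congr 2
    have : (Real.pi : ℂ) ≠ 0 := by exact_mod_cast Real.pi_ne_zero
    push_cast
    field_simp
    ring

theorem fhat_sub {f g : ℝ → ℂ} (hf : PerInt f) (hg : PerInt g) (n : ℤ) :
    fhat (fun x => f x - g x) n = fhat f n - fhat g n := by
  simp only [fhat_eq, sub_mul]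
  rw [intervalIntegral.integral_sub, mul_sub]
  · exact (hf.mul_continuous (expZ_periodic _) (continuous_expZ _)).integrable _ _
  · exact (hg.mul_continuous (expZ_periodic _) (continuous_expZ _)).integrable _ _

theorem fhat_comp_neg (f : ℝ → ℂ) (n : ℤ) : fhat (fun x => f (-x)) n = fhat f (-n) := by
  simp only [fhat_eq, neg_neg]
  congr 1
  have h := intervalIntegral.integral_comp_neg (a := -Real.pi) (b := Real.pi)
    fun x => f x * expZ n x
  rw [neg_neg] at h
  rw [← h]
  simp only [expZ_apply_neg]

theorem norm_integral_mul_le {f φ : ℝ → ℂ} {B : ℝ} (hf : PerInt f)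
    (hφ : ∀ x ∈ Set.Icc (-Real.pi) Real.pi, ‖φ x‖ ≤ B) :
    ‖∫ x in (-Real.pi)..Real.pi, f x * φ x‖ ≤ B * normL f := by
  unfold normL
  rw [← intervalIntegral.integral_const_mul]
  refine intervalIntegral.norm_integral_le_of_norm_le neg_pi_le_pi ?_
    ((hf.integrable _ _).norm.const_mul B)
  refine Filter.Eventually.of_forall fun x hx => ?_
  rw [norm_mul, mul_comm]
  exact mul_le_mul_of_nonneg_right (hφ x (Set.Ioc_subset_Icc_self hx)) (norm_nonneg _)

theorem norm_fhat_le {f : ℝ → ℂ} (hf : PerInt f) (n : ℤ) : ‖fhat f n‖ ≤ normL f := by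
  rw [fhat_eq, norm_mul]
  have h := norm_integral_mul_le (φ := expZ (-n)) (B := 1) hf fun x _ => (norm_expZ _ _).le
  have h1 : ‖(2 * (Real.pi : ℂ))⁻¹‖ ≤ 1 := by
    rw [norm_inv, norm_mul, Complex.norm_real, Real.norm_of_nonneg Real.pi_pos.le]
    apply inv_le_one_of_one_le₀
    simp only [Complex.norm_ofNat]
    linarith [Real.pi_gt_three]
  calc _ ≤ 1 * (1 * normL f) := mul_le_mul h1 h (norm_nonneg _) zero_le_one
    _ = _ := by ring

theorem fhat_expZ (k n : ℤ) : fhat (expZ k) n = if k = n then 1 else 0 := by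
  rw [fhat_eq]
  simp only [← expZ_add, integral_expZ, ← sub_eq_add_neg, sub_eq_zero]
  split_ifs
  · exact inv_mul_cancel₀ (by simp)
  · simp

theorem perInt_sum_expZ (s : Finset ℤ) (a : ℤ → ℂ) :
    PerInt (fun x => ∑ k ∈ s, a k * expZ k x) := by
  refine PerInt.of_continuous (fun x => ?_) ?_
  · simp only [expZ_periodic _ x]
  · exact continuous_finsetSum _ fun k _ => continuous_const.mul (continuous_expZ k)

theorem fhat_sum_expZ (s : Finset ℤ) (a : ℤ → ℂ) (n : ℤ) :
    fhat (fun x => ∑ k ∈ s, a k * expZ k x) n = if n ∈ s then a n else 0 := by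
  rw [fhat_eq]
  simp only [Finset.sum_mul, mul_assoc]
  rw [intervalIntegral.integral_finsetSum, Finset.mul_sum]
  · have : ∀ k ∈ s, (2 * (Real.pi : ℂ))⁻¹ *
        ∫ x in (-Real.pi)..Real.pi, a k * (expZ k x * expZ (-n) x) = if k = n then a k else 0 := by
      intro k _
      rw [intervalIntegral.integral_const_mul, mul_left_comm, ← fhat_eq, fhat_expZ]
      simp
    rw [Finset.sum_congr rfl this]
    simp
  · intro k _
    exact (continuous_const.mul ((continuous_expZ _).mul (continuous_expZ _))).intervalIntegrable _ _

/-! ### Trigonometric polynomials -/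

/-- Trigonometric polynomials of degree at most `n`. -/
noncomputable def trigPoly (n : ℕ) : Submodule ℂ (ℝ → ℂ) :=
  Submodule.span ℂ (expZ '' {k : ℤ | |k| ≤ n})

theorem expZ_mem_trigPoly {n : ℕ} {k : ℤ} (hk : |k| ≤ n) : expZ k ∈ trigPoly n :=
  Submodule.subset_span ⟨k, hk, rfl⟩

theorem trigPoly_mono {m n : ℕ} (h : m ≤ n) : trigPoly m ≤ trigPoly n :=
  Submodule.span_mono (Set.image_mono fun k (hk : |k| ≤ m) =>
    (hk.trans (by exact_mod_cast h) : |k| ≤ n))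

theorem mul_mem_trigPoly {m n : ℕ} {S T : ℝ → ℂ} (hS : S ∈ trigPoly m) (hT : T ∈ trigPoly n) :
    S * T ∈ trigPoly (m + n) := by
  have h := Submodule.mul_mem_mul hS hT
  rw [trigPoly, trigPoly, Submodule.span_mul_span] at h
  refine Submodule.span_mono ?_ h
  rintro _ ⟨_, ⟨k, hk, rfl⟩, _, ⟨l, hl, rfl⟩, rfl⟩
  refine ⟨k + l, ?_, funext fun x => expZ_add k l x⟩
  simp only [Set.mem_ofPred_eq] at hk hl ⊢
  push_cast
  exact (abs_add_le _ _).trans (add_le_add hk hl)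

theorem perInt_and_continuous_of_mem_trigPoly {n : ℕ} {T : ℝ → ℂ} (hT : T ∈ trigPoly n) :
    PerInt T ∧ Continuous T := by
  suffices h : Function.Periodic T (2 * Real.pi) ∧ Continuous T from
    ⟨PerInt.of_continuous h.1 h.2, h.2⟩
  induction hT using Submodule.span_induction with
  | mem T h =>
    obtain ⟨k, -, rfl⟩ := h
    exact ⟨expZ_periodic k, continuous_expZ k⟩
  | zero => exact ⟨fun x => rfl, continuous_const⟩
  | add S T _ _ hS hT => exact ⟨hS.1.add hT.1, hS.2.add hT.2⟩
  | smul a T _ hT => exact ⟨hT.1.smul a, hT.2.const_smul a⟩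

theorem exists_antideriv_of_mem_trigPoly {n : ℕ} {T : ℝ → ℂ} (hT : T ∈ trigPoly n) :
    -- The constant c removes the zero frequency, which has no periodic antiderivative.
    ∃ Q ∈ trigPoly n, ∃ c : ℂ, ∀ x, HasDerivAt Q (T x - c) x := by
  induction hT using Submodule.span_induction with
  | mem T h =>
    obtain ⟨k, hk, rfl⟩ := h
    rcases eq_or_ne k 0 with rfl | h0
    · refine ⟨0, Submodule.zero_mem _, 1, fun x => ?_⟩
      rw [expZ_zero, sub_self]
      exact hasDerivAt_const x 0
    · have hk' : Complex.I * (k : ℂ) ≠ 0 := mul_ne_zero Complex.I_ne_zero (by exact_mod_cast h0)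
      refine ⟨(Complex.I * (k : ℂ))⁻¹ • expZ k, Submodule.smul_mem _ _ (expZ_mem_trigPoly hk), 0,
        fun x => ?_⟩
      have := (hasDerivAt_expZ k x).const_smul (Complex.I * (k : ℂ))⁻¹
      rwa [smul_eq_mul, inv_mul_cancel_left₀ hk', ← sub_zero (expZ k x)] at this
  | zero => exact ⟨0, Submodule.zero_mem _, 0, fun x => by simp⟩
  | add S T _ _ hS hT =>
    obtain ⟨P, hP, c, hc⟩ := hS
    obtain ⟨Q, hQ, d, hd⟩ := hT
    refine ⟨P + Q, Submodule.add_mem _ hP hQ, c + d, fun x => ?_⟩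
    rw [Pi.add_apply, add_sub_add_comm]
    exact (hc x).add (hd x)
  | smul a T _ hT =>
    obtain ⟨Q, hQ, d, hd⟩ := hT
    refine ⟨a • Q, Submodule.smul_mem _ a hQ, a • d, fun x => ?_⟩
    rw [Pi.smul_apply, ← smul_sub]
    exact (hd x).const_smul a

theorem eq_sum_fhat_of_mem_trigPoly {n : ℕ} {T : ℝ → ℂ} (hT : T ∈ trigPoly n) {s : Finset ℤ}
    (hs : ∀ k : ℤ, |k| ≤ n → k ∈ s) (x : ℝ) : ∑ k ∈ s, fhat T k * expZ k x = T x := by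
  have hex : ∃ a : ℤ → ℂ, T = fun x => ∑ k ∈ s, a k * expZ k x := by
    induction hT using Submodule.span_induction with
    | mem T h =>
      obtain ⟨k, hk, rfl⟩ := h
      refine ⟨fun l => if l = k then 1 else 0, ?_⟩
      funext x
      simp [hs k hk]
    | zero => exact ⟨0, by ext; simp⟩
    | add S T _ _ hS hT =>
      obtain ⟨a, rfl⟩ := hS
      obtain ⟨b, rfl⟩ := hT
      refine ⟨a + b, ?_⟩
      funext x
      simp [add_mul, Finset.sum_add_distrib]
    | smul c T _ hT =>
      obtain ⟨a, rfl⟩ := hT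
      refine ⟨c • a, ?_⟩
      funext x
      simp [Finset.mul_sum, mul_assoc]
  obtain ⟨a, rfl⟩ := hex
  refine Finset.sum_congr rfl fun k hk => ?_
  rw [fhat_sum_expZ, if_pos hk]

/-! ### Minkowski's integral inequality and convolutions -/

/-- Minkowski's inequality by Tonelli for extended nonnegative integrals. Only the majorant B has to
be integrable in t, not the norms of the slices. -/
theorem integral_norm_integral_le {μ ν : Measure ℝ} [SFinite μ] [SFinite ν] {F : ℝ → ℝ → ℂ}
    (hF : Measurable (Function.uncurry F)) {B : ℝ → ℝ} (hB : Integrable B μ)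
    (hint : ∀ t, Integrable (F t) ν) (hle : ∀ t, ∫ x, ‖F t x‖ ∂ν ≤ B t) :
    ∫ x, ‖∫ t, F t x ∂μ‖ ∂ν ≤ ∫ t, B t ∂μ := by
  have hB0 : ∀ t, 0 ≤ B t := fun t => (integral_nonneg fun _ => norm_nonneg _).trans (hle t)
  have hm : StronglyMeasurable fun x => ∫ t, F t x ∂μ :=
    (hF.comp measurable_swap).stronglyMeasurable.integral_prod_right (f := fun x t => F t x)
  rw [integral_norm_eq_lintegral_enorm hm.aestronglyMeasurable]
  refine ENNReal.toReal_le_of_le_ofReal (integral_nonneg hB0) ?_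
  calc ∫⁻ x, ‖∫ t, F t x ∂μ‖ₑ ∂ν ≤ ∫⁻ x, ∫⁻ t, ‖F t x‖ₑ ∂μ ∂ν :=
        lintegral_mono fun x => enorm_integral_le_lintegral_enorm _
    _ = ∫⁻ t, ∫⁻ x, ‖F t x‖ₑ ∂ν ∂μ :=
        lintegral_lintegral_swap (hF.comp measurable_swap).enorm.aemeasurable
    _ ≤ ∫⁻ t, ENNReal.ofReal (B t) ∂μ := by
        refine lintegral_mono fun t => ?_
        rw [← ofReal_integral_norm_eq_lintegral_enorm (hint t)]
        exact ENNReal.ofReal_le_ofReal (hle t)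
    _ = ENNReal.ofReal (∫ t, B t ∂μ) :=
        (ofReal_integral_eq_lintegral_ofReal hB (Filter.Eventually.of_forall hB0)).symm

theorem normL_integral_le {a b : ℝ} (hab : a ≤ b) {F : ℝ → ℝ → ℂ}
    (hF : Measurable (Function.uncurry F)) {B : ℝ → ℝ} (hB : IntervalIntegrable B volume a b)
    (hint : ∀ t, PerInt (F t)) (hle : ∀ t, normL (F t) ≤ B t) :
    normL (fun x => ∫ t in a..b, F t x) ≤ ∫ t in a..b, B t := by
  unfold normL at hle ⊢
  simp only [intervalIntegral.integral_of_le hab,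
    intervalIntegral.integral_of_le neg_pi_le_pi] at hle ⊢
  exact integral_norm_integral_le hF hB.1 (fun t => ((hint t).integrable _ _).1) hle

theorem normL_translate_sub_le_abs_mul {f f' : ℝ → ℂ} (hf' : PerInt f')
    (h : ∀ a b, ∫ x in a..b, f' x = f b - f a) {s : ℝ} (hs : 0 ≤ s) :
    normL (fun x => f (x + s) - f x) ≤ s * normL f' := by
  have h1 : (fun x => f (x + s) - f x) = fun x => ∫ t in (0 : ℝ)..s, f' (x + t) := by
    funext x
    rw [intervalIntegral.integral_comp_add_left (fun t => f' t), h, add_zero]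
  rw [h1]
  refine (normL_integral_le (F := fun t x => f' (x + t)) (B := fun _ => normL f') hs ?_
    intervalIntegrable_const (fun t => hf'.comp_add t)
    fun t => (normL_comp_add hf'.periodic t).le).trans_eq ?_
  · exact hf'.measurable.comp (measurable_snd.add measurable_fst)
  · simp

/-- The convolution of `g` and `K` over a period. -/
noncomputable def perConv (g K : ℝ → ℂ) (x : ℝ) : ℂ :=
  ∫ u in (-Real.pi)..Real.pi, g u * K (x - u)

theorem normL_perConv_le {g K : ℝ → ℂ} (hg : PerInt g) (hK : PerInt K) :
    normL (perConv g K) ≤ normL g * normL K := by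
  unfold perConv
  refine (normL_integral_le (F := fun u x => g u * K (x - u)) (B := fun u => ‖g u‖ * normL K)
    neg_pi_le_pi ?_ ((hg.integrable _ _).norm.mul_const _) (fun u => ?_) fun u => ?_).trans_eq ?_
  · exact (hg.measurable.comp measurable_fst).mul
      (hK.measurable.comp (measurable_snd.sub measurable_fst))
  · have h := hK.comp_add (-u)
    simp only [← sub_eq_add_neg] at h
    exact ⟨fun x => by simp only [h.periodic x], h.measurable.const_mul _,
      fun a b => (h.integrable a b).const_mul _⟩
  · have h := normL_comp_add hK.periodic (-u)
    simp only [← sub_eq_add_neg] at h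
    rw [← h]
    simp only [normL, norm_mul, intervalIntegral.integral_const_mul]
    exact le_rfl
  · rw [intervalIntegral.integral_mul_const]
    rfl

theorem perConv_eq_integral_sub {g K : ℝ → ℂ} (hg : Function.Periodic g (2 * Real.pi))
    (hK : Function.Periodic K (2 * Real.pi)) (x : ℝ) :
    perConv g K x = ∫ t in (-Real.pi)..Real.pi, g (x - t) * K t := by
  have hp : Function.Periodic (fun u => g u * K (x - u)) (2 * Real.pi) := fun u => by
    simp only [hg u, sub_add_eq_sub_sub, hK.sub_eq]
  have h := intervalIntegral.integral_comp_sub_left (a := -Real.pi) (b := Real.pi)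
    (fun u => g u * K (x - u)) x
  simp only [sub_sub_cancel] at h
  rw [h, perConv]
  have h2 := hp.intervalIntegral_add_eq (-Real.pi) (x - Real.pi)
  convert h2 using 2 <;> ring

theorem perConv_expZ {g : ℝ → ℂ} (k : ℤ) (x : ℝ) :
    perConv g (expZ k) x = 2 * Real.pi * fhat g k * expZ k x := by
  have hpi : (Real.pi : ℂ) ≠ 0 := by exact_mod_cast Real.pi_ne_zero
  have h : ∀ u, g u * expZ k (x - u) = g u * expZ (-k) u * expZ k x := fun u => by
    rw [sub_eq_add_neg, expZ_apply_add, expZ_apply_neg]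
    ring
  simp only [perConv, h]
  rw [intervalIntegral.integral_mul_const, fhat_eq]
  field_simp

theorem PerInt.intervalIntegrable_mul_comp_sub {g K : ℝ → ℂ} (hg : PerInt g) (hK : Continuous K)
    (x : ℝ) : IntervalIntegrable (fun u => g u * K (x - u)) volume (-Real.pi) Real.pi :=
  (hg.integrable _ _).mul_continuousOn (hK.comp (continuous_const.sub continuous_id)).continuousOn

theorem perConv_mem_trigPoly {g K : ℝ → ℂ} {n : ℕ} (hg : PerInt g) (hK : K ∈ trigPoly n) :
    perConv g K ∈ trigPoly n := by
  induction hK using Submodule.span_induction with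
  | mem T h =>
    obtain ⟨k, hk, rfl⟩ := h
    have h : perConv g (expZ k) = (2 * Real.pi * fhat g k : ℂ) • expZ k :=
      funext fun x => perConv_expZ k x
    rw [h]
    exact Submodule.smul_mem _ _ (expZ_mem_trigPoly hk)
  | zero =>
    have h : perConv g 0 = 0 := funext fun x => by simp [perConv]
    rw [h]
    exact Submodule.zero_mem _
  | add S T hS' hT' hS hT =>
    have h : perConv g (S + T) = perConv g S + perConv g T := funext fun x => by
      simp only [perConv, Pi.add_apply, mul_add]
      exact intervalIntegral.integral_add
        (hg.intervalIntegrable_mul_comp_sub (perInt_and_continuous_of_mem_trigPoly hS').2 x)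
        (hg.intervalIntegrable_mul_comp_sub (perInt_and_continuous_of_mem_trigPoly hT').2 x)
    rw [h]
    exact Submodule.add_mem _ hS hT
  | smul c T _ hT =>
    have h : perConv g (c • T) = c • perConv g T := funext fun x => by
      simp only [perConv, Pi.smul_apply, smul_eq_mul, mul_left_comm _ c]
      exact intervalIntegral.integral_const_mul _ _
    rw [h]
    exact Submodule.smul_mem _ c hT

/-! ### Geometric sums of exponentials -/

/-- The one-sided Dirichlet kernel `∑_{j < m} e^{ijx}`. -/
noncomputable def geomExp (m : ℕ) (x : ℝ) : ℂ := ∑ j ∈ Finset.range m, expZ j x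

theorem continuous_geomExp (m : ℕ) : Continuous (geomExp m) :=
  continuous_finsetSum _ fun j _ => continuous_expZ j

theorem norm_geomExp_le (m : ℕ) (x : ℝ) : ‖geomExp m x‖ ≤ m := by
  refine (norm_sum_le _ _).trans ?_
  simp [norm_expZ]

theorem expZ_natCast (j : ℕ) (x : ℝ) : expZ j x = expZ 1 x ^ j := by
  rw [expZ, expZ, ← Complex.exp_nat_mul]
  congr 1
  push_cast
  ring

theorem two_div_pi_mul_abs_le_norm_expZ_one_sub_one {x : ℝ} (hx : |x| ≤ Real.pi) :
    2 / Real.pi * |x| ≤ ‖expZ 1 x - 1‖ := by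
  have h : expZ 1 x = Complex.exp (Complex.I * x) := by simp [expZ]
  rw [h, Complex.norm_exp_I_mul_ofReal_sub_one, norm_mul, Real.norm_eq_abs, Real.norm_eq_abs,
    abs_two]
  have h1 : |Real.sin (x / 2)| = Real.sin (|x| / 2) := by
    rcases le_total 0 x with h0 | h0
    · rw [abs_of_nonneg h0] at hx ⊢
      exact abs_of_nonneg (Real.sin_nonneg_of_nonneg_of_le_pi (by linarith) (by linarith))
    · rw [abs_of_nonpos h0] at hx ⊢
      rw [neg_div, Real.sin_neg]
      exact abs_of_nonpos (Real.sin_nonpos_of_nonpos_of_neg_pi_le (by linarith) (by linarith))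
  rw [h1]
  have h2 := Real.mul_le_sin (x := |x| / 2) (by positivity) (by linarith)
  linarith

theorem norm_geomExp_mul_abs_le (m : ℕ) {x : ℝ} (hx : |x| ≤ Real.pi) :
    ‖geomExp m x‖ * |x| ≤ Real.pi := by
  have h : geomExp m x * (expZ 1 x - 1) = expZ 1 x ^ m - 1 := by
    simp only [geomExp, expZ_natCast]
    exact geom_sum_mul _ _
  have h1 : ‖geomExp m x‖ * ‖expZ 1 x - 1‖ ≤ 2 := by
    rw [← norm_mul, h]
    refine (norm_sub_le _ _).trans ?_
    rw [norm_pow, norm_expZ]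
    norm_num
  have h2 := mul_le_mul_of_nonneg_left (two_div_pi_mul_abs_le_norm_expZ_one_sub_one hx)
    (norm_nonneg (geomExp m x))
  have hpi := Real.pi_pos
  have h3 : ‖geomExp m x‖ * (2 / Real.pi * |x|) = 2 / Real.pi * (‖geomExp m x‖ * |x|) := by ring
  rw [h3] at h2
  have h4 := h2.trans h1
  rw [div_mul_eq_mul_div, div_le_iff₀ hpi] at h4
  linarith

/-- The bounds L and π/|x| are merged into one continuous majorant whose integral over a period is
logarithmic in L. -/
theorem norm_geomExp_le_div {m L : ℕ} (hm : m ≤ L) (hL : 1 ≤ L) {x : ℝ} (hx : |x| ≤ Real.pi) :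
    ‖geomExp m x‖ ≤ (1 + Real.pi) * (|x| + (L : ℝ)⁻¹)⁻¹ := by
  have hL' : (0 : ℝ) < L := by exact_mod_cast hL
  rw [← div_eq_mul_inv, le_div_iff₀ (by positivity), mul_add]
  have h1 := norm_geomExp_mul_abs_le m hx
  have h2 : ‖geomExp m x‖ * (L : ℝ)⁻¹ ≤ 1 := by
    rw [← div_eq_mul_inv, div_le_one hL']
    exact (norm_geomExp_le m x).trans (by exact_mod_cast hm)
  linarith

theorem half_le_norm_geomExp {m : ℕ} {x : ℝ} (hx0 : 0 ≤ x) (hx : m * x ≤ 1) :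
    (m : ℝ) / 2 ≤ ‖geomExp m x‖ := by
  refine le_trans ?_ (Complex.re_le_norm _)
  rw [geomExp, Complex.re_sum]
  -- Here 0 ≤ jx ≤ 1, so cos(jx) ≥ 1 - 1/2.
  have h : ∀ j ∈ Finset.range m, (1 / 2 : ℝ) ≤ (expZ j x).re := fun j hj => by
    rw [expZ_eq_exp_mul_I, Complex.exp_ofReal_mul_I_re]
    have hj' : (j : ℝ) ≤ m := by exact_mod_cast (Finset.mem_range.1 hj).le
    have h0 : 0 ≤ (j : ℝ) * x := by positivity
    have h1 : (j : ℝ) * x ≤ 1 := (mul_le_mul_of_nonneg_right hj' hx0).trans hx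
    have h2 := Real.one_sub_sq_div_two_le_cos (x := (j : ℝ) * x)
    push_cast
    nlinarith
  calc (m : ℝ) / 2 = ∑ j ∈ Finset.range m, (1 / 2 : ℝ) := by simp [div_eq_mul_inv]
    _ ≤ _ := Finset.sum_le_sum h

theorem integral_norm_sum_expZ_sq (s : Finset ℤ) :
    ∫ x in (-Real.pi)..Real.pi, ‖∑ k ∈ s, expZ k x‖ ^ 2 = 2 * Real.pi * s.card := by
  have h : ∀ x, ((‖∑ k ∈ s, expZ k x‖ ^ 2 : ℝ) : ℂ) = ∑ k ∈ s, ∑ l ∈ s, expZ (k - l) x := fun x => by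
    push_cast
    rw [← Complex.mul_conj', map_sum, Finset.sum_mul_sum]
    simp only [conj_expZ, ← expZ_add, sub_eq_add_neg]
  have h2 : ((∫ x in (-Real.pi)..Real.pi, ‖∑ k ∈ s, expZ k x‖ ^ 2 : ℝ) : ℂ)
      = ((2 * Real.pi * s.card : ℝ) : ℂ) := by
    rw [← intervalIntegral.integral_ofReal]
    simp only [h]
    rw [intervalIntegral.integral_finsetSum fun k _ =>
      (continuous_finsetSum _ fun l _ => continuous_expZ _).intervalIntegrable _ _]
    have : ∀ k ∈ s, ∫ x in (-Real.pi)..Real.pi, ∑ l ∈ s, expZ (k - l) x = 2 * (Real.pi : ℂ) := by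
      intro k hk
      rw [intervalIntegral.integral_finsetSum fun l _ => (continuous_expZ _).intervalIntegrable _ _]
      simp only [integral_expZ, sub_eq_zero]
      simp [hk]
    rw [Finset.sum_congr rfl this]
    simp
    ring
  exact_mod_cast h2

theorem integral_norm_geomExp_sq (m : ℕ) :
    ∫ x in (-Real.pi)..Real.pi, ‖geomExp m x‖ ^ 2 = 2 * Real.pi * m := by
  have h := integral_norm_sum_expZ_sq ((Finset.range m).map Nat.castEmbedding)
  simpa [geomExp] using h

/-! ### Jackson's theorem in `L¹` -/

/-- The peak alone suffices: on [0, 1/m] the integrand is at least (m/2)^4. This is the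
normalisation of the Jackson kernel. -/
theorem cube_div_le_integral_norm_geomExp_pow_four {m : ℕ} (hm : 1 ≤ m) :
    (m : ℝ) ^ 3 / 16 ≤ ∫ x in (-Real.pi)..Real.pi, ‖geomExp m x‖ ^ 4 := by
  have hm' : (1 : ℝ) ≤ m := by exact_mod_cast hm
  have hc : Continuous fun x => ‖geomExp m x‖ ^ 4 := (continuous_geomExp m).norm.pow 4
  have hinv : (m : ℝ)⁻¹ ≤ 1 := inv_le_one_of_one_le₀ hm'
  have hpi := Real.pi_gt_three
  calc (m : ℝ) ^ 3 / 16 = ∫ x in (0 : ℝ)..(m : ℝ)⁻¹, ((m : ℝ) / 2) ^ 4 := by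
        rw [intervalIntegral.integral_const, sub_zero, smul_eq_mul]
        field_simp
        norm_num
    _ ≤ ∫ x in (0 : ℝ)..(m : ℝ)⁻¹, ‖geomExp m x‖ ^ 4 := by
        refine intervalIntegral.integral_mono_on (by positivity) intervalIntegrable_const
          (hc.intervalIntegrable _ _) fun x hx => ?_
        refine pow_le_pow_left₀ (by positivity) (half_le_norm_geomExp hx.1 ?_) 4
        calc (m : ℝ) * x ≤ m * (m : ℝ)⁻¹ := mul_le_mul_of_nonneg_left hx.2 (by positivity)
          _ = 1 := mul_inv_cancel₀ (by positivity)
    _ ≤ ∫ x in (-Real.pi)..Real.pi, ‖geomExp m x‖ ^ 4 :=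
        intervalIntegral.integral_mono_interval (by linarith) (by positivity) (by linarith)
          (Filter.Eventually.of_forall fun x => by positivity) (hc.intervalIntegrable _ _)

/-- Of the four kernel factors one absorbs |x| at the cost of π, one is at most m, and the other two
are integrated by Parseval. -/
theorem integral_abs_mul_norm_geomExp_pow_four_le (m : ℕ) :
    ∫ x in (-Real.pi)..Real.pi, |x| * ‖geomExp m x‖ ^ 4 ≤ 2 * Real.pi ^ 2 * (m : ℝ) ^ 2 := by
  have hA := (continuous_geomExp m).norm
  calc ∫ x in (-Real.pi)..Real.pi, |x| * ‖geomExp m x‖ ^ 4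
      ≤ ∫ x in (-Real.pi)..Real.pi, Real.pi * m * ‖geomExp m x‖ ^ 2 := by
        refine intervalIntegral.integral_mono_on neg_pi_le_pi
          ((continuous_abs.mul (hA.pow 4)).intervalIntegrable _ _)
          ((continuous_const.mul (hA.pow 2)).intervalIntegrable _ _) fun x hx => ?_
        have h1 := norm_geomExp_mul_abs_le m (abs_le.2 hx)
        have h2 := mul_le_mul h1 (norm_geomExp_le m x) (norm_nonneg _) Real.pi_pos.le
        calc |x| * ‖geomExp m x‖ ^ 4
            = ‖geomExp m x‖ * |x| * ‖geomExp m x‖ * ‖geomExp m x‖ ^ 2 := by ring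
          _ ≤ _ := mul_le_mul_of_nonneg_right h2 (by positivity)
    _ = 2 * Real.pi ^ 2 * (m : ℝ) ^ 2 := by
        rw [intervalIntegral.integral_const_mul, integral_norm_geomExp_sq]
        ring

theorem geomExp_mem_trigPoly (m : ℕ) : geomExp m ∈ trigPoly (m - 1) := by
  have h : geomExp m = ∑ j ∈ Finset.range m, expZ j := by
    funext x
    simp [geomExp]
  rw [h]
  refine Submodule.sum_mem _ fun j hj => expZ_mem_trigPoly ?_
  rw [Finset.mem_range] at hj
  rw [Nat.abs_cast]
  exact_mod_cast (by lia : j ≤ m - 1)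

theorem conj_geomExp_mem_trigPoly (m : ℕ) :
    (fun x => (starRingEnd ℂ) (geomExp m x)) ∈ trigPoly (m - 1) := by
  have h : (fun x => (starRingEnd ℂ) (geomExp m x)) = ∑ j ∈ Finset.range m, expZ (-j) := by
    funext x
    simp [geomExp, conj_expZ]
  rw [h]
  refine Submodule.sum_mem _ fun j hj => expZ_mem_trigPoly ?_
  rw [Finset.mem_range] at hj
  rw [abs_neg, Nat.abs_cast]
  exact_mod_cast (by lia : j ≤ m - 1)

theorem norm_geomExp_pow_four_mem_trigPoly {m n : ℕ} (h : 4 * (m - 1) ≤ n) :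
    (fun x => ((‖geomExp m x‖ ^ 4 : ℝ) : ℂ)) ∈ trigPoly n := by
  have h1 := mul_mem_trigPoly (geomExp_mem_trigPoly m) (conj_geomExp_mem_trigPoly m)
  have h2 := mul_mem_trigPoly h1 h1
  refine trigPoly_mono (by lia) (?_ : _ ∈ trigPoly (m - 1 + (m - 1) + (m - 1 + (m - 1))))
  convert h2 using 1
  funext x
  simp only [Pi.mul_apply, Complex.mul_conj']
  push_cast
  ring

/-- The approximant is the convolution with the normalised Jackson kernel j, proportional to
|`geomExp m`|^4. Since j has mean one, the error is an average of translation differences,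
controlled by the first absolute moment of j, which is O(1/m). -/
theorem exists_trigPoly_normL_sub_le_modulusL :
    ∃ C : ℝ, 0 < C ∧ ∀ (g : ℝ → ℂ) (n : ℕ), PerInt g → ∃ T ∈ trigPoly n,
      normL (fun x => g x - T x) ≤ C * modulusL g (((n : ℝ) + 1)⁻¹) := by
  refine ⟨(1 + 32 * Real.pi ^ 2) * 4, by positivity, fun g n hg => ?_⟩
  obtain ⟨m, hm, hmn, hnm⟩ : ∃ m : ℕ, 1 ≤ m ∧ 4 * (m - 1) ≤ n ∧ n + 1 ≤ 4 * m :=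
    -- The kernel then has degree at most n, while 1/m ≤ 4/(n+1), which costs a factor 4 in the
    -- modulus.
    ⟨n / 4 + 1, by lia, by lia, by lia⟩
  have hm' : (0 : ℝ) < m := by exact_mod_cast hm
  have hI1 := cube_div_le_integral_norm_geomExp_pow_four hm
  have hI2 := integral_abs_mul_norm_geomExp_pow_four_le m
  set I := ∫ x in (-Real.pi)..Real.pi, ‖geomExp m x‖ ^ 4 with hI
  have hI0 : 0 < I := lt_of_lt_of_le (by positivity) hI1
  have hA := (continuous_geomExp m).norm
  set j : ℝ → ℝ := fun t => I⁻¹ * ‖geomExp m t‖ ^ 4 with hj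
  have hjc : Continuous j := continuous_const.mul (hA.pow 4)
  have hj0 : ∀ t, 0 ≤ j t := fun t => by positivity
  have hj1 : ∫ t in (-Real.pi)..Real.pi, j t = 1 := by
    rw [hj, intervalIntegral.integral_const_mul, ← hI, inv_mul_cancel₀ hI0.ne']
  have hJ : (fun t => (j t : ℂ)) ∈ trigPoly n := by
    have h := Submodule.smul_mem _ ((I⁻¹ : ℝ) : ℂ) (norm_geomExp_pow_four_mem_trigPoly hmn)
    convert h using 1
    funext t
    simp [hj]
  have hJp := (perInt_and_continuous_of_mem_trigPoly hJ).1
  refine ⟨perConv g fun t => (j t : ℂ), perConv_mem_trigPoly hg hJ, ?_⟩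
  set w := modulusL g ((m : ℝ)⁻¹) with hw
  have hw0 : 0 ≤ w := modulusL_nonneg _ _
  have hsub : (fun x => g x - perConv g (fun t => (j t : ℂ)) x) =
      fun x => ∫ t in (-Real.pi)..Real.pi, (g x - g (x - t)) * (j t : ℂ) := by
    funext x
    rw [perConv_eq_integral_sub hg.periodic hJp.periodic]
    have h1 : g x = ∫ t in (-Real.pi)..Real.pi, g x * (j t : ℂ) := by
      rw [intervalIntegral.integral_const_mul, intervalIntegral.integral_ofReal, hj1]
      simp
    simp only [sub_mul]
    rw [intervalIntegral.integral_sub, ← h1]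
    · exact (continuous_const.mul (Complex.continuous_ofReal.comp hjc)).intervalIntegrable _ _
    · have h2 : IntervalIntegrable (fun t => g (x - t)) volume (-Real.pi) Real.pi := by
        have h3 := (hg.comp_neg.comp_add (-x)).integrable (-Real.pi) Real.pi
        simpa [neg_add, add_comm, sub_eq_add_neg] using h3
      exact h2.mul_continuousOn (Complex.continuous_ofReal.comp hjc).continuousOn
  have hBc : Continuous fun t => ((1 + m * |t|) * w) * j t :=
    ((continuous_const.add (continuous_const.mul continuous_abs)).mul continuous_const).mul hjc
  have h1 : normL (fun x => g x - perConv g (fun t => (j t : ℂ)) x) ≤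
      ∫ t in (-Real.pi)..Real.pi, ((1 + m * |t|) * w) * j t := by
    rw [hsub]
    refine normL_integral_le (F := fun t x => (g x - g (x - t)) * (j t : ℂ)) neg_pi_le_pi ?_
      (hBc.intervalIntegrable _ _) (fun t => ?_) fun t => ?_
    · exact ((hg.measurable.comp measurable_snd).sub (hg.measurable.comp
        (measurable_snd.sub measurable_fst))).mul
        ((Complex.continuous_ofReal.comp hjc).measurable.comp measurable_fst)
    · have h := hg.sub (hg.comp_add (-t))
      simp only [← sub_eq_add_neg] at h
      exact h.mul_continuous (fun _ => rfl) continuous_const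
    · have h := normL_translate_sub_le hg hm (-t)
      rw [abs_neg] at h
      simp only [normL, norm_mul, intervalIntegral.integral_mul_const, Complex.norm_real,
        Real.norm_of_nonneg (hj0 t)] at h ⊢
      refine mul_le_mul_of_nonneg_right (le_trans (le_of_eq ?_) h) (hj0 t)
      refine intervalIntegral.integral_congr fun x _ => ?_
      rw [norm_sub_rev, sub_eq_add_neg x t]
  have h2 : ∫ t in (-Real.pi)..Real.pi, ((1 + m * |t|) * w) * j t ≤ (1 + 32 * Real.pi ^ 2) * w := by
    have h3 : ∀ t, ((1 + m * |t|) * w) * j t =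
        w * j t + w * m * I⁻¹ * (|t| * ‖geomExp m t‖ ^ 4) := fun t => by
      simp only [hj]
      ring
    simp only [h3]
    have c1 : Continuous fun t => w * j t := continuous_const.mul hjc
    have c2 : Continuous fun t => w * m * I⁻¹ * (|t| * ‖geomExp m t‖ ^ 4) :=
      continuous_const.mul (continuous_abs.mul (hA.pow 4))
    rw [intervalIntegral.integral_add (c1.intervalIntegrable _ _) (c2.intervalIntegrable _ _),
      intervalIntegral.integral_const_mul w, hj1, intervalIntegral.integral_const_mul]
    have h4 : m * I⁻¹ * (∫ t in (-Real.pi)..Real.pi, |t| * ‖geomExp m t‖ ^ 4) ≤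
        32 * Real.pi ^ 2 := by
      rw [mul_right_comm, ← div_eq_mul_inv, div_le_iff₀ hI0]
      calc (m : ℝ) * _ ≤ m * (2 * Real.pi ^ 2 * (m : ℝ) ^ 2) :=
            mul_le_mul_of_nonneg_left hI2 hm'.le
        _ = 32 * Real.pi ^ 2 * ((m : ℝ) ^ 3 / 16) := by ring
        _ ≤ _ := mul_le_mul_of_nonneg_left hI1 (by positivity)
    have h5 := mul_le_mul_of_nonneg_left h4 hw0
    linarith
  have h6 : w ≤ 4 * modulusL g (((n : ℝ) + 1)⁻¹) := by
    refine (modulusL_mono hg ?_).trans (modulusL_nat_mul_le hg (((n : ℝ) + 1)⁻¹) 4)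
    rw [← div_eq_mul_inv, inv_le_comm₀ hm' (by positivity), inv_div, div_le_iff₀ (by norm_num)]
    push_cast
    have : ((n + 1 : ℕ) : ℝ) ≤ ((4 * m : ℕ) : ℝ) := by exact_mod_cast hnm
    push_cast at this
    linarith
  calc _ ≤ (1 + 32 * Real.pi ^ 2) * w := h1.trans h2
    _ ≤ (1 + 32 * Real.pi ^ 2) * (4 * modulusL g (((n : ℝ) + 1)⁻¹)) :=
        mul_le_mul_of_nonneg_left h6 (by positivity)
    _ = _ := by ring

/-! ### Jackson's theorem for differentiable functions. -/

theorem Function.Periodic.deriv_of_real {f : ℝ → ℂ} {c : ℝ} (hf : Function.Periodic f c) :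
    Function.Periodic (deriv f) c := fun x => by
  rw [← deriv_comp_add_const]
  congr 1
  exact funext hf

theorem IsLocallyAC.continuous {f : ℝ → ℂ} (hf : IsLocallyAC f) : Continuous f := by
  rw [continuous_iff_continuousAt]
  intro x
  refine (hf (x - 1) (x + 1)).continuousOn.continuousAt ?_
  rw [Set.uIcc_of_le (by linarith)]
  exact Icc_mem_nhds (by linarith) (by linarith)

theorem IsLocallyAC.perInt_deriv {f : ℝ → ℂ} (hp : Function.Periodic f (2 * Real.pi))
    (hf : IsLocallyAC f) : PerInt (deriv f) :=
  ⟨hp.deriv_of_real, measurable_deriv f, fun a b => (hf a b).deriv_complex.1⟩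

theorem perInt_iteratedDeriv {f : ℝ → ℂ} (hf : PerInt f) {r : ℕ}
    (hAC : ∀ k < r, IsLocallyAC (iteratedDeriv k f)) : PerInt (iteratedDeriv r f) := by
  induction r with
  | zero => simpa using hf
  | succ r ih =>
    rw [iteratedDeriv_succ]
    exact (hAC r (by lia)).perInt_deriv (ih fun k hk => hAC k (by lia)).periodic

/-- Each derivative gains a factor 1/(n+1). If T approximates f' and Q' = T - c, then f - Q has
derivative f' - T + c, so its modulus at 1/(n+1) is at most ‖f' - T + c‖/(n+1); the case r = 0 is
applied to f - Q. -/
theorem exists_trigPoly_normL_sub_le (r : ℕ) :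
    ∃ C : ℝ, 0 < C ∧ ∀ (f : ℝ → ℂ) (n : ℕ), PerInt f →
      (∀ k < r, IsLocallyAC (iteratedDeriv k f)) → ∃ T ∈ trigPoly n,
        normL (fun x => f x - T x) ≤
          C * (((n : ℝ) + 1) ^ (-(r : ℤ)) * modulusL (iteratedDeriv r f) (((n : ℝ) + 1)⁻¹)) := by
  obtain ⟨C₀, hC₀, H₀⟩ := exists_trigPoly_normL_sub_le_modulusL
  induction r with
  | zero =>
    refine ⟨C₀, hC₀, fun f n hf _ => ?_⟩
    simpa using H₀ f n hf
  | succ r ih =>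
    obtain ⟨C, hC, H⟩ := ih
    refine ⟨C₀ * (2 * C), by positivity, fun f n hf hAC => ?_⟩
    have hf0 : IsLocallyAC f := by simpa using hAC 0 (by lia)
    have hf' := hf0.perInt_deriv hf.periodic
    obtain ⟨T, hT, hTle⟩ := H (deriv f) n hf' fun k hk => by
      rw [← iteratedDeriv_succ']
      exact hAC (k + 1) (by lia)
    rw [← iteratedDeriv_succ'] at hTle
    set ψ := modulusL (iteratedDeriv (r + 1) f) (((n : ℝ) + 1)⁻¹) with hψ
    obtain ⟨Q, hQ, c, hQd⟩ := exists_antideriv_of_mem_trigPoly hT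
    have hTp := (perInt_and_continuous_of_mem_trigPoly hT)
    have hQp := (perInt_and_continuous_of_mem_trigPoly hQ)
    have hconst : PerInt (fun _ : ℝ => c) :=
      PerInt.of_continuous (fun _ => rfl) continuous_const
    have hd := hf'.sub hTp.1
    have hprim : ∀ a b, ∫ x in a..b, ((deriv f x - T x) + c) =
        (fun x => f x - Q x) b - (fun x => f x - Q x) a := fun a b => by
      have h1 : ∀ x, (deriv f x - T x) + c = deriv f x - (T x - c) := fun x => by ring
      simp only [h1]
      rw [intervalIntegral.integral_sub (hf'.integrable a b) ((hTp.1.sub hconst).integrable a b),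
        (hf0 a b).deriv_complex.2, intervalIntegral.integral_eq_sub_of_hasDerivAt
          (fun x _ => hQd x) ((hTp.1.sub hconst).integrable a b)]
      ring
    -- By periodicity f' - T + c integrates to zero over a period, so c is minus the mean of f' - T.
    have hcle : normL (fun _ => c) ≤ normL (fun x => deriv f x - T x) := by
      have h1 := hprim (-Real.pi) Real.pi
      beta_reduce at h1
      have hp := (hf.sub hQp.1).periodic (-Real.pi)
      rw [show -Real.pi + 2 * Real.pi = Real.pi by ring] at hp
      rw [hp, sub_self, intervalIntegral.integral_add (hd.integrable _ _) (hconst.integrable _ _),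
        intervalIntegral.integral_const] at h1
      have h2 : normL (fun _ => c) = ‖(Real.pi - -Real.pi) • c‖ := by
        simp only [normL, intervalIntegral.integral_const, norm_smul, smul_eq_mul]
        rw [Real.norm_of_nonneg (by linarith [Real.pi_pos])]
      rw [h2, ← norm_neg, ← eq_neg_of_add_eq_zero_left h1]
      exact intervalIntegral.norm_integral_le_integral_norm neg_pi_le_pi
    obtain ⟨P, hP, hPle⟩ := H₀ (fun x => f x - Q x) n (hf.sub hQp.1)
    refine ⟨Q + P, Submodule.add_mem _ hQ hP, ?_⟩
    have hn : (0 : ℝ) < (n : ℝ) + 1 := by positivity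
    have hmod : modulusL (fun x => f x - Q x) (((n : ℝ) + 1)⁻¹) ≤
        ((n : ℝ) + 1)⁻¹ * (2 * (C * (((n : ℝ) + 1) ^ (-(r : ℤ)) * ψ))) := by
      have hψ0 : 0 ≤ ψ := modulusL_nonneg _ _
      refine modulusL_le (by positivity) fun s h0 h1 => ?_
      refine (normL_translate_sub_le_abs_mul (hd.add hconst) hprim h0).trans ?_
      refine mul_le_mul h1 ?_ (normL_nonneg _) (by positivity)
      refine (normL_add_le hd hconst).trans ?_
      linarith
    have hpow : ((n : ℝ) + 1) ^ (-((r + 1 : ℕ) : ℤ)) =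
        ((n : ℝ) + 1)⁻¹ * ((n : ℝ) + 1) ^ (-(r : ℤ)) := by
      push_cast
      rw [neg_add, zpow_add₀ hn.ne', zpow_neg_one, mul_comm]
    calc normL (fun x => f x - (Q + P) x) = normL (fun x => f x - Q x - P x) := by
          simp only [Pi.add_apply, sub_sub]
      _ ≤ C₀ * (((n : ℝ) + 1)⁻¹ * (2 * (C * (((n : ℝ) + 1) ^ (-(r : ℤ)) * ψ)))) :=
          hPle.trans (mul_le_mul_of_nonneg_left hmod hC₀.le)
      _ = _ := by
          rw [hpow]
          ring

/-! ### De la Vallée Poussin means -/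

/-- The frequencies of the wide factor of the de la Vallée Poussin kernel. -/
noncomputable def wideBlock (n : ℕ) : Finset ℤ := Finset.Icc (1 - 2 * (n : ℤ)) n

/-- The de la Vallée Poussin mean, as an average of shifted partial sums. -/
noncomputable def vpMean (f : ℝ → ℂ) (n : ℕ) (x : ℝ) : ℂ :=
  (n : ℂ)⁻¹ * ∑ i ∈ Finset.range n, ∑ j ∈ wideBlock n, fhat f (i + j) * expZ (i + j) x

/-- The de la Vallée Poussin kernel. -/
noncomputable def vpKernel (n : ℕ) (x : ℝ) : ℂ :=
  (2 * Real.pi * n : ℂ)⁻¹ * (geomExp n x * ∑ j ∈ wideBlock n, expZ j x)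

theorem continuous_vpKernel (n : ℕ) : Continuous (vpKernel n) :=
  continuous_const.mul ((continuous_geomExp n).mul
    (continuous_finsetSum _ fun j _ => continuous_expZ j))

theorem vpKernel_eq_sum (n : ℕ) (x : ℝ) :
    vpKernel n x = ∑ p ∈ Finset.range n ×ˢ wideBlock n,
      (2 * Real.pi * n : ℂ)⁻¹ * expZ (p.1 + p.2) x := by
  rw [vpKernel, geomExp, Finset.sum_mul_sum, ← Finset.sum_product', Finset.mul_sum]
  simp only [expZ_add]

theorem perInt_vpKernel (n : ℕ) : PerInt (vpKernel n) := by
  refine PerInt.of_continuous (fun x => ?_) (continuous_vpKernel n)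
  simp only [vpKernel_eq_sum, expZ_periodic _ x]

/-- The kernel is a product of exponential sums with n and 3n frequencies, so 2ab ≤ a² + b² and
Parseval give (2πn + 6πn)/(4πn) = 2, independent of n. -/
theorem normL_vpKernel_le {n : ℕ} (hn : 1 ≤ n) : normL (vpKernel n) ≤ 2 := by
  have hn' : (0 : ℝ) < n := by exact_mod_cast hn
  have hpi := Real.pi_pos
  have hA : Continuous fun x => ‖geomExp n x‖ ^ 2 := (continuous_geomExp n).norm.pow 2
  have hB : Continuous fun x => ‖∑ j ∈ wideBlock n, expZ j x‖ ^ 2 :=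
    (continuous_finsetSum _ fun j _ => continuous_expZ j).norm.pow 2
  have hcard : ((wideBlock n).card : ℝ) = 3 * n := by
    have : (wideBlock n).card = 3 * n := by
      rw [wideBlock, Int.card_Icc]
      lia
    rw [this]
    push_cast
    ring
  have hc : ‖(2 * Real.pi * n : ℂ)⁻¹‖ = (2 * Real.pi * n)⁻¹ := by
    rw [norm_inv, norm_mul, norm_mul, Complex.norm_real, Real.norm_of_nonneg hpi.le]
    simp
  calc normL (vpKernel n) ≤ ∫ x in (-Real.pi)..Real.pi, (2 * Real.pi * n)⁻¹ * (1 / 2) *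
        (‖geomExp n x‖ ^ 2 + ‖∑ j ∈ wideBlock n, expZ j x‖ ^ 2) := by
        refine intervalIntegral.integral_mono_on neg_pi_le_pi
          ((continuous_vpKernel n).norm.intervalIntegrable _ _)
          (Continuous.intervalIntegrable (by fun_prop) _ _) fun x _ => ?_
        rw [vpKernel, norm_mul, norm_mul, hc, mul_assoc (2 * Real.pi * (n : ℝ))⁻¹]
        refine mul_le_mul_of_nonneg_left ?_ (by positivity)
        linarith [two_mul_le_add_sq ‖geomExp n x‖ ‖∑ j ∈ wideBlock n, expZ j x‖]
    _ = 2 := by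
        rw [intervalIntegral.integral_const_mul, intervalIntegral.integral_add
          (hA.intervalIntegrable _ _) (hB.intervalIntegrable _ _), integral_norm_geomExp_sq,
          integral_norm_sum_expZ_sq, hcard]
        field_simp
        norm_num

theorem perConv_sum_const_mul_expZ {f : ℝ → ℂ} (hf : PerInt f) {ι : Type*} (s : Finset ι)
    (φ : ι → ℤ) (κ : ℂ) (x : ℝ) :
    perConv f (fun t => ∑ p ∈ s, κ * expZ (φ p) t) x =
      ∑ p ∈ s, κ * (2 * Real.pi) * (fhat f (φ p) * expZ (φ p) x) := by
  have h : ∀ p ∈ s, IntervalIntegrable (fun u => f u * (κ * expZ (φ p) (x - u))) volume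
      (-Real.pi) Real.pi := fun p _ => hf.intervalIntegrable_mul_comp_sub
        (K := fun t => κ * expZ (φ p) t) (continuous_const.mul (continuous_expZ _)) x
  simp only [perConv, Finset.mul_sum]
  rw [intervalIntegral.integral_finsetSum h]
  refine Finset.sum_congr rfl fun p _ => ?_
  have h1 := perConv_expZ (g := f) (φ p) x
  rw [perConv] at h1
  simp only [mul_left_comm (f _)]
  rw [intervalIntegral.integral_const_mul, h1]
  ring

theorem vpMean_eq_perConv {f : ℝ → ℂ} (hf : PerInt f) (n : ℕ) :
    vpMean f n = perConv f (vpKernel n) := by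
  have hpi : (2 * Real.pi : ℂ) ≠ 0 := by simp
  have hκ : (2 * Real.pi * n : ℂ)⁻¹ * (2 * Real.pi) = (n : ℂ)⁻¹ := by
    rw [mul_inv, mul_right_comm, inv_mul_cancel₀ hpi, one_mul]
  funext x
  rw [funext (vpKernel_eq_sum n), perConv_sum_const_mul_expZ hf, hκ, ← Finset.mul_sum,
    Finset.sum_product, vpMean]

theorem perInt_vpMean (f : ℝ → ℂ) (n : ℕ) : PerInt (vpMean f n) := by
  refine PerInt.of_continuous (fun x => ?_) ?_
  · simp only [vpMean, expZ_periodic _ x]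
  · exact continuous_const.mul (continuous_finsetSum _ fun i _ => continuous_finsetSum _ fun j _ =>
      continuous_const.mul (continuous_expZ _))

theorem normL_vpMean_le {f : ℝ → ℂ} (hf : PerInt f) {n : ℕ} (hn : 1 ≤ n) :
    normL (vpMean f n) ≤ 2 * normL f := by
  rw [vpMean_eq_perConv hf, mul_comm]
  exact (normL_perConv_le hf (perInt_vpKernel n)).trans
    (mul_le_mul_of_nonneg_left (normL_vpKernel_le hn) (normL_nonneg f))

theorem sum_wideBlock {β : Type*} [AddCommMonoid β] (G : ℤ → β) (n i : ℕ) :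
    ∑ j ∈ wideBlock n, G (i + j) = ∑ k ∈ Finset.Icc (i + 1 - 2 * n : ℤ) (i + n), G k := by
  rw [wideBlock, ← Finset.sum_image (f := G) (g := fun j => (i : ℤ) + j)
    (fun a _ b _ h => add_left_cancel h), Finset.image_add_left_Icc]
  congr 2
  ring

theorem vpMean_of_mem_trigPoly {n : ℕ} (hn : 1 ≤ n) {T : ℝ → ℂ} (hT : T ∈ trigPoly n) (x : ℝ) :
    vpMean T n x = T x := by
  have hn' : (n : ℂ) ≠ 0 := by
    have : n ≠ 0 := by lia
    exact_mod_cast this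
  -- For i < n the window [i+1-2n, i+n] contains [-n, n], so every shifted partial sum already
  -- reproduces T.
  have h : ∀ i ∈ Finset.range n,
      ∑ j ∈ wideBlock n, fhat T (i + j) * expZ (i + j) x = T x := fun i hi => by
    rw [Finset.mem_range] at hi
    rw [sum_wideBlock (fun k => fhat T k * expZ k x)]
    refine eq_sum_fhat_of_mem_trigPoly hT (fun k hk => ?_) x
    rw [abs_le] at hk
    rw [Finset.mem_Icc]
    lia
  rw [vpMean, Finset.sum_congr rfl h]
  simp [hn']

theorem vpMean_sub {f g : ℝ → ℂ} (hf : PerInt f) (hg : PerInt g) (n : ℕ) (x : ℝ) :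
    vpMean (fun x => f x - g x) n x = vpMean f n x - vpMean g n x := by
  simp only [vpMean, fhat_sub hf hg, sub_mul, Finset.sum_sub_distrib, mul_sub]

theorem normL_sub_vpMean_le {f T : ℝ → ℂ} (hf : PerInt f) {n : ℕ} (hn : 1 ≤ n)
    (hT : T ∈ trigPoly n) :
    normL (fun x => f x - vpMean f n x) ≤ 3 * normL (fun x => f x - T x) := by
  have hTp := (perInt_and_continuous_of_mem_trigPoly hT).1
  have h : (fun x => f x - vpMean f n x) =
      fun x => (f x - T x) - vpMean (fun x => f x - T x) n x := by
    funext x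
    rw [vpMean_sub hf hTp, vpMean_of_mem_trigPoly hn hT]
    ring
  rw [h]
  refine (normL_sub_le (hf.sub hTp) (perInt_vpMean _ _)).trans ?_
  have := normL_vpMean_le (hf.sub hTp) hn
  linarith

/-! ### De la Vallée Poussin means compared with partial sums. -/

theorem sum_Icc_eq_add_sum_range (G : ℤ → ℂ) (n p q : ℕ) :
    ∑ k ∈ Finset.Icc (-(n : ℤ) - p) (n + q), G k = ∑ k ∈ Finset.Icc (-(n : ℤ)) n, G k +
      (∑ j ∈ Finset.range q, G ((n + 1 + j : ℕ) : ℤ) +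
        ∑ j ∈ Finset.range p, G (-((n + 1 + j : ℕ) : ℤ))) := by
  induction p with
  | zero =>
    induction q with
    | zero => simp
    | succ q ih =>
      have h : Finset.Icc (-(n : ℤ) - (0 : ℕ)) (n + (q + 1 : ℕ)) =
          insert ((n + 1 + q : ℕ) : ℤ) (Finset.Icc (-(n : ℤ) - (0 : ℕ)) (n + q)) := by
        ext k
        simp only [Finset.mem_insert, Finset.mem_Icc]
        lia
      rw [h, Finset.sum_insert (by simp only [Finset.mem_Icc]; lia), ih, Finset.sum_range_succ]
      ring
  | succ p ih =>
    have h : Finset.Icc (-(n : ℤ) - (p + 1 : ℕ)) (n + q) =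
        insert (-((n + 1 + p : ℕ) : ℤ)) (Finset.Icc (-(n : ℤ) - p) (n + q)) := by
      ext k
      simp only [Finset.mem_insert, Finset.mem_Icc]
      lia
    rw [h, Finset.sum_insert (by simp only [Finset.mem_Icc]; lia), ih, Finset.sum_range_succ _ p]
    ring

theorem partialSum_eq (f : ℝ → ℂ) (n : ℕ) (x : ℝ) :
    partialSum f n x = ∑ k ∈ Finset.Icc (-(n : ℤ)) n, fhat f k * expZ k x := rfl

theorem perInt_partialSum (f : ℝ → ℂ) (n : ℕ) : PerInt (partialSum f n) :=
  perInt_sum_expZ _ _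

/-- A block of a trigonometric series with coefficients `c`, of length `L`, beginning after the
frequency `n`. -/
noncomputable def expBlock (c : ℕ → ℂ) (n L : ℕ) (x : ℝ) : ℂ :=
  ∑ j ∈ Finset.range L, c (n + 1 + j) * expZ ((n + 1 + j : ℕ) : ℤ) x

theorem perInt_expBlock (c : ℕ → ℂ) (n L : ℕ) : PerInt (expBlock c n L) := by
  refine PerInt.of_continuous (fun x => ?_) ?_
  · simp only [expBlock, expZ_periodic _ x]
  · exact continuous_finsetSum _ fun j _ => continuous_const.mul (continuous_expZ _)

/-- The i-th window exceeds [-n, n] by i frequencies above and n-1-i below; the lower block becomes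
one with positive frequencies at -x. -/
theorem vpMean_sub_partialSum {n : ℕ} (hn : 1 ≤ n) (f : ℝ → ℂ) (x : ℝ) :
    vpMean f n x - partialSum f n x = (n : ℂ)⁻¹ * ∑ i ∈ Finset.range n,
      (expBlock (fun k => fhat f k) n i x + expBlock (fun k => fhat f (-k)) n (n - 1 - i) (-x)) := by
  have hn' : (n : ℂ) ≠ 0 := by
    have : n ≠ 0 := by lia
    exact_mod_cast this
  have h : ∀ i ∈ Finset.range n, ∑ j ∈ wideBlock n, fhat f (i + j) * expZ (i + j) x =
      partialSum f n x +
      (expBlock (fun k => fhat f k) n i x + expBlock (fun k => fhat f (-k)) n (n - 1 - i) (-x)) := by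
    intro i hi
    rw [Finset.mem_range] at hi
    rw [sum_wideBlock (fun k => fhat f k * expZ k x), partialSum_eq]
    have h1 := sum_Icc_eq_add_sum_range (fun k => fhat f k * expZ k x) n (n - 1 - i) i
    have h2 : Finset.Icc (-(n : ℤ) - (n - 1 - i : ℕ)) (n + i) =
        Finset.Icc (i + 1 - 2 * n : ℤ) (i + n) := by
      congr 1 <;> lia
    rw [h2] at h1
    simp only [expBlock, expZ_apply_neg]
    exact h1
  rw [vpMean, Finset.sum_congr rfl h, Finset.sum_add_distrib, mul_add]
  simp [hn']

theorem normL_vpMean_sub_partialSum_le {n : ℕ} (hn : 1 ≤ n) (f : ℝ → ℂ) {B : ℝ}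
    (hpos : ∀ L ≤ n, normL (expBlock (fun k => fhat f k) n L) ≤ B)
    (hneg : ∀ L ≤ n, normL (expBlock (fun k => fhat f (-k)) n L) ≤ B) :
    normL (fun x => vpMean f n x - partialSum f n x) ≤ 2 * B := by
  have hn' : (0 : ℝ) < n := by exact_mod_cast hn
  set F : ℕ → ℝ → ℂ := fun i x =>
    expBlock (fun k => fhat f k) n i x + expBlock (fun k => fhat f (-k)) n (n - 1 - i) (-x) with hF
  have hFp : ∀ i, PerInt (F i) := fun i => (perInt_expBlock _ _ _).add (perInt_expBlock _ _ _).comp_neg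
  have hFle : ∀ i ∈ Finset.range n, normL (F i) ≤ 2 * B := fun i hi => by
    rw [Finset.mem_range] at hi
    refine (normL_add_le (perInt_expBlock _ _ _) (perInt_expBlock _ _ _).comp_neg).trans ?_
    rw [normL_comp_neg]
    have h1 := hpos i hi.le
    have h2 := hneg (n - 1 - i) (by lia)
    linarith
  have hsum : ∀ s : Finset ℕ, normL (fun x => ∑ i ∈ s, F i x) ≤ ∑ i ∈ s, normL (F i) := fun s => by
    simp only [normL]
    rw [← intervalIntegral.integral_finsetSum fun i _ => ((hFp i).integrable _ _).norm]
    refine intervalIntegral.integral_mono_on neg_pi_le_pi ?_ ?_ fun x _ => norm_sum_le _ _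
    · have h := IntervalIntegrable.sum s fun i _ => (hFp i).integrable (-Real.pi) Real.pi
      simpa using h.norm
    · have h := IntervalIntegrable.sum s fun i _ => ((hFp i).integrable (-Real.pi) Real.pi).norm
      rw [Finset.sum_fn] at h
      exact h
  simp only [vpMean_sub_partialSum hn]
  have h1 : normL (fun x => (n : ℂ)⁻¹ * ∑ i ∈ Finset.range n, F i x) =
      (n : ℝ)⁻¹ * normL (fun x => ∑ i ∈ Finset.range n, F i x) := by
    simp [normL, intervalIntegral.integral_const_mul]
  refine h1.trans_le ?_
  rw [inv_mul_le_iff₀ hn']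
  refine (hsum _).trans ((Finset.sum_le_sum hFle).trans_eq ?_)
  simp

/-! ### Summation by parts -/

/-- Abel's summation by parts. For L = 0 the truncated index L - 1 is 0 and the bound is harmless.
-/
theorem norm_sum_mul_le_of_norm_sum_le {a b : ℕ → ℂ} {L : ℕ} {B : ℝ}
    (hB : ∀ j ≤ L, ‖∑ i ∈ Finset.range j, b i‖ ≤ B) :
    ‖∑ i ∈ Finset.range L, a i * b i‖ ≤
      B * (‖a (L - 1)‖ + ∑ i ∈ Finset.range (L - 1), ‖a i - a (i + 1)‖) := by
  have h := Finset.sum_range_by_parts a b L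
  simp only [smul_eq_mul] at h
  rw [h, mul_add, mul_comm B, Finset.mul_sum _ _ B]
  refine (norm_sub_le _ _).trans (add_le_add ?_ ((norm_sum_le _ _).trans
    (Finset.sum_le_sum fun i hi => ?_)))
  · rw [norm_mul]
    exact mul_le_mul_of_nonneg_left (hB L le_rfl) (norm_nonneg _)
  · rw [Finset.mem_range] at hi
    rw [norm_mul, norm_sub_rev, mul_comm]
    exact mul_le_mul_of_nonneg_right (hB _ (by lia)) (norm_nonneg _)

theorem integral_abs_add_inv {ε : ℝ} (hε : 0 < ε) :
    ∫ x in (-Real.pi)..Real.pi, (|x| + ε)⁻¹ = 2 * Real.log ((Real.pi + ε) / ε) := by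
  have hpi := Real.pi_pos
  have hc : Continuous fun x : ℝ => (|x| + ε)⁻¹ :=
    (continuous_abs.add continuous_const).inv₀ fun x => (by positivity : 0 < |x| + _).ne'
  have h0 : ∫ x in (0 : ℝ)..Real.pi, (|x| + ε)⁻¹ = Real.log ((Real.pi + ε) / ε) := by
    have h1 : ∫ x in (0 : ℝ)..Real.pi, (|x| + ε)⁻¹ = ∫ x in (0 : ℝ)..Real.pi, (x + ε)⁻¹ := by
      refine intervalIntegral.integral_congr fun x hx => ?_
      rw [Set.uIcc_of_le hpi.le] at hx
      simp only [abs_of_nonneg hx.1]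
    rw [h1, intervalIntegral.integral_comp_add_right (fun x => x⁻¹), zero_add,
      integral_inv_of_pos hε (by positivity)]
  have h2 : ∫ x in (-Real.pi)..0, (|x| + ε)⁻¹ = ∫ x in (0 : ℝ)..Real.pi, (|x| + ε)⁻¹ := by
    have h := intervalIntegral.integral_comp_neg (a := 0) (b := Real.pi)
      fun x : ℝ => (|x| + ε)⁻¹
    simpa using h.symm
  rw [← intervalIntegral.integral_add_adjacent_intervals (hc.intervalIntegrable (-Real.pi) 0)
    (hc.intervalIntegrable 0 Real.pi), h2, h0, two_mul]

theorem log_pi_mul_add_one_le {n : ℕ} (hn : 1 ≤ n) :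
    Real.log (Real.pi * n + 1) ≤ 3 * Real.log (n + 1) := by
  have hn' : (1 : ℝ) ≤ n := by exact_mod_cast hn
  have hpi := Real.pi_pos
  have h : Real.pi * n + 1 ≤ ((n : ℝ) + 1) ^ 3 := by
    have h1 := mul_le_mul_of_nonneg_right Real.pi_le_four (zero_le_one.trans hn')
    nlinarith [mul_nonneg (sub_nonneg.2 hn') (sub_nonneg.2 hn'), pow_pos (zero_lt_one.trans_le hn') 3]
  calc Real.log (Real.pi * n + 1) ≤ Real.log (((n : ℝ) + 1) ^ 3) :=
        Real.log_le_log (by positivity) h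
    _ = 3 * Real.log (n + 1) := by
        rw [Real.log_pow]
        norm_num

theorem normL_expBlock_le (c : ℕ → ℂ) {n L : ℕ} (hn : 1 ≤ n) (hL : L ≤ n) :
    normL (expBlock c n L) ≤ 6 * (1 + Real.pi) * Real.log (n + 1) *
      (‖c (n + 1 + (L - 1))‖ +
        ∑ i ∈ Finset.range (L - 1), ‖c (n + 1 + i) - c (n + 1 + (i + 1))‖) := by
  have hn' : (0 : ℝ) < n := by exact_mod_cast hn
  have hpi := Real.pi_pos
  set V := ‖c (n + 1 + (L - 1))‖ +
        ∑ i ∈ Finset.range (L - 1), ‖c (n + 1 + i) - c (n + 1 + (i + 1))‖ with hV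
  have hV0 : 0 ≤ V := by positivity
  have hpt : ∀ x ∈ Set.Icc (-Real.pi) Real.pi,
      ‖expBlock c n L x‖ ≤ (1 + Real.pi) * V * (|x| + (n : ℝ)⁻¹)⁻¹ := fun x hx => by
    -- Factoring out the unimodular e^{i(n+1)x} leaves a sum whose exponential partial sums are
    -- one-sided Dirichlet kernels.
    have h1 : expBlock c n L x =
        expZ (n + 1 : ℕ) x * ∑ j ∈ Finset.range L, c (n + 1 + j) * expZ j x := by
      rw [expBlock, Finset.mul_sum]
      refine Finset.sum_congr rfl fun j _ => ?_
      rw [Nat.cast_add (n + 1) j, expZ_add]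
      ring
    rw [h1, norm_mul, norm_expZ, one_mul]
    refine (norm_sum_mul_le_of_norm_sum_le (a := fun j => c (n + 1 + j)) (b := fun j => expZ j x)
      (B := (1 + Real.pi) * (|x| + (n : ℝ)⁻¹)⁻¹) fun j hj => ?_).trans_eq ?_
    · exact norm_geomExp_le_div (hj.trans hL) hn (abs_le.2 hx)
    · rw [hV]
      ring
  have hc : Continuous fun x : ℝ => (1 + Real.pi) * V * (|x| + (n : ℝ)⁻¹)⁻¹ :=
    continuous_const.mul ((continuous_abs.add continuous_const).inv₀ fun x => (by positivity : 0 < |x| + _).ne')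
  have h2 : normL (expBlock c n L) ≤ (1 + Real.pi) * V * (2 * Real.log (Real.pi * n + 1)) := by
    refine (intervalIntegral.integral_mono_on neg_pi_le_pi
      ((perInt_expBlock c n L).integrable _ _).norm (hc.intervalIntegrable _ _) hpt).trans_eq ?_
    rw [intervalIntegral.integral_const_mul, integral_abs_add_inv (by positivity)]
    congr 3
    field_simp
  refine h2.trans ?_
  calc _ ≤ (1 + Real.pi) * V * (2 * (3 * Real.log (n + 1))) :=
        mul_le_mul_of_nonneg_left (by linarith [log_pi_mul_add_one_le hn]) (by positivity)
    _ = _ := by ring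

/-! ### Bounded partial sums of the sawtooth series -/

/-- Abel summation with decreasing coefficients: the variation telescopes to 1/(p+1) ≤ x, which
cancels the bound π/x on the exponential sums. -/
theorem norm_sum_natCast_add_one_inv_mul_expZ_le {x : ℝ} (hx0 : 0 < x) (hx : x ≤ Real.pi)
    {p : ℕ} (hp : 1 ≤ (p + 1) * x) (L : ℕ) :
    ‖∑ j ∈ Finset.range L, (((p + j + 1 : ℝ)⁻¹ : ℝ) : ℂ) * expZ (p + j + 1 : ℕ) x‖ ≤ Real.pi := by
  rcases L.eq_zero_or_pos with rfl | hL
  · simpa using Real.pi_pos.le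
  have hB : ∀ j ≤ L, ‖∑ i ∈ Finset.range j, expZ (p + i + 1 : ℕ) x‖ ≤ Real.pi / x := fun j _ => by
    have h1 : ∑ i ∈ Finset.range j, expZ (p + i + 1 : ℕ) x = expZ (p + 1 : ℕ) x * geomExp j x := by
      rw [geomExp, Finset.mul_sum]
      refine Finset.sum_congr rfl fun i _ => ?_
      rw [← expZ_add]
      congr 1
      push_cast
      ring
    rw [h1, norm_mul, norm_expZ, one_mul, le_div_iff₀ hx0]
    have h2 := norm_geomExp_mul_abs_le j (x := x) (by rwa [abs_of_pos hx0])
    rwa [abs_of_pos hx0] at h2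
  refine (norm_sum_mul_le_of_norm_sum_le hB).trans ?_
  set v : ℕ → ℝ := fun j => (p + j + 1 : ℝ)⁻¹ with hv
  have hanti : ∀ i, v (i + 1) ≤ v i := fun i => by
    simp only [hv]
    refine inv_anti₀ (by positivity) ?_
    push_cast
    linarith
  have h1 : ∀ i, ‖((v i : ℝ) : ℂ) - ((v (i + 1) : ℝ) : ℂ)‖ = v i - v (i + 1) := fun i => by
    rw [← Complex.ofReal_sub, Complex.norm_real, Real.norm_of_nonneg (sub_nonneg.2 (hanti i))]
  have h2 : ‖((v (L - 1) : ℝ) : ℂ)‖ = v (L - 1) := by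
    rw [Complex.norm_real, Real.norm_of_nonneg (by simp only [hv]; positivity)]
  change Real.pi / x * (‖((v (L - 1) : ℝ) : ℂ)‖ +
    ∑ i ∈ Finset.range (L - 1), ‖((v i : ℝ) : ℂ) - ((v (i + 1) : ℝ) : ℂ)‖) ≤ Real.pi
  simp only [h1, h2]
  rw [Finset.sum_range_sub', add_sub_cancel, div_mul_eq_mul_div, div_le_iff₀ hx0]
  refine mul_le_mul_of_nonneg_left ?_ Real.pi_pos.le
  simp only [hv, Nat.cast_zero, add_zero]
  rw [inv_le_iff_one_le_mul₀' (by positivity)]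
  exact hp

theorem abs_sum_sin_div_le_of_pos {x : ℝ} (hx0 : 0 < x) (hx : x ≤ Real.pi) (N : ℕ) :
    |∑ k ∈ Finset.range N, (k + 1 : ℝ)⁻¹ * Real.sin ((k + 1) * x)| ≤ 1 + Real.pi := by
  have hsmall : ∀ p : ℕ, p * x ≤ 1 →
      |∑ k ∈ Finset.range p, (k + 1 : ℝ)⁻¹ * Real.sin ((k + 1) * x)| ≤ 1 := fun p hp => by
    refine (Finset.abs_sum_le_sum_abs _ _).trans (le_trans ?_ hp)
    refine (Finset.sum_le_card_nsmul _ _ x fun k _ => ?_).trans_eq (by simp)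
    rw [abs_mul, abs_of_nonneg (by positivity), inv_mul_le_iff₀ (by positivity)]
    refine (Real.abs_sin_le_abs).trans_eq (abs_of_nonneg (by positivity))
  have hfl := Nat.floor_le (inv_nonneg.2 hx0.le)
  have hfl' := Nat.lt_floor_add_one x⁻¹
  -- Up to 1/x each term is at most x in absolute value, for a total of at most 1; beyond it the
  -- oscillation gives at most π.
  set p := ⌊x⁻¹⌋₊ with hpdef
  have hp1 : p * x ≤ 1 := by
    rwa [← le_div_iff₀ hx0, one_div]
  rcases le_total N p with h | h
  · refine (hsmall N ?_).trans (by linarith [Real.pi_pos])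
    exact (mul_le_mul_of_nonneg_right (by exact_mod_cast h) hx0.le).trans hp1
  · obtain ⟨L, rfl⟩ := Nat.exists_eq_add_of_le h
    rw [Finset.sum_range_add]
    refine (abs_add_le _ _).trans (add_le_add (hsmall p hp1) ?_)
    have h1 := norm_sum_natCast_add_one_inv_mul_expZ_le hx0 hx (p := p) (by
      rw [inv_lt_iff_one_lt_mul₀ hx0] at hfl'
      linarith) L
    refine le_trans (le_of_eq ?_) ((Complex.abs_im_le_norm _).trans h1)
    rw [Complex.im_sum]
    congr 1
    refine Finset.sum_congr rfl fun j _ => ?_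
    rw [Complex.im_ofReal_mul, expZ_eq_exp_mul_I, Complex.exp_ofReal_mul_I_im]
    push_cast
    rfl

theorem abs_sum_sin_div_le {x : ℝ} (hx : x ∈ Set.Icc (-Real.pi) Real.pi) (N : ℕ) :
    |∑ k ∈ Finset.range N, (k + 1 : ℝ)⁻¹ * Real.sin ((k + 1) * x)| ≤ 1 + Real.pi := by
  rcases lt_trichotomy 0 x with h | rfl | h
  · exact abs_sum_sin_div_le_of_pos h hx.2 N
  · simp only [mul_zero, Real.sin_zero, Finset.sum_const_zero, abs_zero]
    positivity
  · have h1 := abs_sum_sin_div_le_of_pos (x := -x) (by linarith) (by linarith [hx.1]) N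
    simpa only [mul_neg, Real.sin_neg, Finset.sum_neg_distrib, abs_neg] using h1

theorem norm_sum_fhat_div_le {h : ℝ → ℂ} (hh : PerInt h) {n : ℕ}
    (h0 : ∀ k : ℤ, |k| ≤ n → fhat h k = 0) :
    ‖∑ k ∈ Finset.range (2 * n), (((k + 1 : ℝ)⁻¹ : ℝ) : ℂ) * fhat h (n + 1 + k : ℕ)‖ ≤
      2 * normL h := by
  have hpi := Real.pi_pos
  set φ : ℝ → ℂ := fun x => expZ (-n) x *
    ((∑ k ∈ Finset.range (2 * n), (k + 1 : ℝ)⁻¹ * Real.sin ((k + 1) * x) : ℝ) : ℂ) with hφ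
  have h1 : ‖∫ x in (-Real.pi)..Real.pi, h x * φ x‖ ≤ (1 + Real.pi) * normL h :=
    norm_integral_mul_le hh fun x hx => by
      rw [hφ, norm_mul, norm_expZ, one_mul, Complex.norm_real]
      exact abs_sum_sin_div_le hx _
  have h2 : ∀ x, h x * φ x = ∑ k ∈ Finset.range (2 * n), (((k + 1 : ℝ)⁻¹ : ℝ) : ℂ) *
      (Complex.I / 2) * (h x * expZ (-((n + 1 + k : ℕ) : ℤ)) x -
        h x * expZ (-((n : ℤ) - k - 1)) x) := fun x => by
    simp only [hφ, Complex.ofReal_sum, Finset.mul_sum]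
    refine Finset.sum_congr rfl fun k _ => ?_
    have e1 : expZ (-((n + 1 + k : ℕ) : ℤ)) x = expZ (-n) x * expZ (-(k + 1)) x := by
      rw [← expZ_add]
      congr 1
      push_cast
      ring
    have e2 : expZ (-((n : ℤ) - k - 1)) x = expZ (-n) x * expZ (k + 1) x := by
      rw [← expZ_add]
      congr 1
      ring
    have e3 : ((Real.sin ((k + 1) * x) : ℝ) : ℂ) =
        (expZ (-(k + 1)) x - expZ (k + 1) x) * Complex.I / 2 := by
      rw [Complex.ofReal_sin, Complex.sin, expZ_eq_exp_mul_I, expZ_eq_exp_mul_I]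
      push_cast
      ring_nf
    rw [e1, e2, Complex.ofReal_mul, e3]
    ring
  have hi : ∀ l : ℤ, IntervalIntegrable (fun x => h x * expZ l x) volume (-Real.pi) Real.pi :=
    fun l => (hh.mul_continuous (expZ_periodic l) (continuous_expZ l)).integrable _ _
  have hf : ∀ l : ℤ, ∫ x in (-Real.pi)..Real.pi, h x * expZ (-l) x = 2 * Real.pi * fhat h l :=
    fun l => by
      rw [fhat_eq, mul_inv_cancel_left₀ (by simp)]
  have h3 : ∫ x in (-Real.pi)..Real.pi, h x * φ x = (Real.pi * Complex.I) *
      ∑ k ∈ Finset.range (2 * n), (((k + 1 : ℝ)⁻¹ : ℝ) : ℂ) * fhat h (n + 1 + k : ℕ) := by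
    simp only [h2]
    rw [intervalIntegral.integral_finsetSum fun k _ => ((hi _).sub (hi _)).const_mul _,
      Finset.mul_sum]
    refine Finset.sum_congr rfl fun k hk => ?_
    rw [Finset.mem_range] at hk
    rw [intervalIntegral.integral_const_mul, intervalIntegral.integral_sub (hi _) (hi _), hf, hf,
      -- Each sine also produces the mirrored frequency n-k-1. For k < 2n it lies in [-n, n-1],
      -- where the coefficients of h vanish; this fixes the length 2n.
      h0 ((n : ℤ) - k - 1) (by rw [abs_le]; lia)]
    ring
  rw [h3, norm_mul, norm_mul, Complex.norm_I, mul_one, Complex.norm_real,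
    Real.norm_of_nonneg hpi.le] at h1
  have h4 : (1 + Real.pi) * normL h ≤ Real.pi * (2 * normL h) := by
    have := normL_nonneg h
    nlinarith [Real.pi_gt_three]
  exact le_of_mul_le_mul_left (h1.trans h4) hpi

/-! ### Sequences of class GBV -/

theorem cos_mul_norm_le_re_of_mem_sectorK {θ : ℝ} (hθ : θ < Real.pi / 2) {z : ℂ}
    (hz : z ∈ sectorK θ) : Real.cos θ * ‖z‖ ≤ z.re := by
  rcases eq_or_ne z 0 with rfl | h0
  · simp
  have hz' : |Complex.arg z| ≤ θ := hz
  have h1 : Real.cos θ ≤ Real.cos (Complex.arg z) := by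
    rw [← Real.cos_abs (Complex.arg z)]
    exact Real.cos_le_cos_of_nonneg_of_le_pi (abs_nonneg _) (by linarith [Real.pi_pos]) hz'
  rw [Complex.cos_arg h0, le_div_iff₀ (norm_pos_iff.2 h0)] at h1
  exact h1

/-- In the sector the real part dominates cos θ times the modulus, so nonnegative combinations
cannot cancel. -/
theorem cos_mul_sum_norm_le {θ : ℝ} (hθ : θ < Real.pi / 2) {ι : Type*} (s : Finset ι)
    (a : ι → ℝ) (z : ι → ℂ) (ha : ∀ i ∈ s, 0 ≤ a i) (hz : ∀ i ∈ s, z i ∈ sectorK θ) :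
    Real.cos θ * ∑ i ∈ s, a i * ‖z i‖ ≤ ‖∑ i ∈ s, (a i : ℂ) * z i‖ := by
  refine le_trans ?_ (Complex.re_le_norm _)
  rw [Complex.re_sum, Finset.mul_sum]
  refine Finset.sum_le_sum fun i hi => ?_
  rw [Complex.re_ofReal_mul, mul_left_comm]
  exact mul_le_mul_of_nonneg_left (cos_mul_norm_le_re_of_mem_sectorK hθ (hz i hi)) (ha i hi)

theorem sup_nnnorm_Ico_le_sum (c : ℕ → ℂ) (m N₀ : ℕ) :
    (((Finset.Ico m (m + N₀)).sup fun n => ‖c n‖₊ : NNReal) : ℝ) ≤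
      ∑ i ∈ Finset.range N₀, ‖c (m + i)‖ := by
  have h : ((Finset.Ico m (m + N₀)).sup fun n => ‖c n‖₊) ≤ ∑ n ∈ Finset.Ico m (m + N₀), ‖c n‖₊ :=
    Finset.sup_le fun n hn => Finset.single_le_sum (f := fun n => ‖c n‖₊) (fun _ _ => zero_le) hn
  rw [Finset.sum_Ico_eq_sum_range, add_tsub_cancel_left] at h
  simpa using NNReal.coe_le_coe.2 h

theorem norm_le_add_sum_Icc (c : ℕ → ℂ) {j N : ℕ} (h1 : j ≤ N) (h2 : N ≤ 2 * j + 1) :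
    ‖c N‖ ≤ ‖c j‖ + ∑ n ∈ Finset.Icc j (2 * j), ‖c n - c (n + 1)‖ := by
  have h3 := dist_le_Ico_sum_dist c h1
  simp only [dist_eq_norm] at h3
  have h4 : ∑ n ∈ Finset.Ico j N, ‖c n - c (n + 1)‖ ≤
      ∑ n ∈ Finset.Icc j (2 * j), ‖c n - c (n + 1)‖ := by
    refine Finset.sum_le_sum_of_subset_of_nonneg (fun k hk => ?_) fun _ _ _ => norm_nonneg _
    rw [Finset.mem_Ico] at hk
    rw [Finset.mem_Icc]
    lia
  have h5 := norm_sub_norm_le (c N) (c j)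
  rw [norm_sub_rev] at h5
  linarith

theorem norm_le_sum_range {c : ℕ → ℂ} {N₀ : ℕ} (hN₀ : 1 ≤ N₀) (m : ℕ) :
    ‖c m‖ ≤ ∑ i ∈ Finset.range N₀, ‖c (m + i)‖ := by
  have h := Finset.single_le_sum (f := fun i => ‖c (m + i)‖) (fun _ _ => norm_nonneg _)
    (Finset.mem_range.2 (by lia : 0 < N₀))
  simpa using h

/-- With n = ⌊N/2⌋, each j = n+1+k with k < n satisfies j ≤ N ≤ 2j+1, so the variation bound at j
controls |c_N| by the N₀ coefficients from j on. Summing over k with weights 1/(k+1) produces the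
logarithm. -/
theorem norm_mul_log_le_sum {c : ℕ → ℂ} {N₀ : ℕ} (hN₀ : 1 ≤ N₀) {M : ℝ} (hM : 0 < M)
    (hc : ∀ m : ℕ, 1 ≤ m → ∑ n ∈ Finset.Icc m (2 * m), ‖c n - c (n + 1)‖ ≤
      M * ∑ i ∈ Finset.range N₀, ‖c (m + i)‖) {N : ℕ} (hN : N₀ ≤ N / 2) :
    ‖c N‖ * Real.log N ≤ 2 * (1 + M) * N₀ ^ 2 *
      ∑ k ∈ Finset.range (2 * (N / 2)), (k + 1 : ℝ)⁻¹ * ‖c (N / 2 + 1 + k)‖ := by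
  obtain ⟨n, hn⟩ : ∃ n, n = N / 2 := ⟨_, rfl⟩
  rw [← hn] at hN ⊢
  set u : ℕ → ℝ := fun k => (k + 1 : ℝ)⁻¹ * ‖c (n + 1 + k)‖ with hu
  have hu0 : ∀ k, 0 ≤ u k := fun k => by positivity
  have hN₀' : (1 : ℝ) ≤ N₀ := by exact_mod_cast hN₀
  have hterm : ∀ k ∈ Finset.range n,
      (k + 1 : ℝ)⁻¹ * ‖c N‖ ≤ (1 + M) * N₀ * ∑ i ∈ Finset.range N₀, u (k + i) := fun k hk => by
    rw [Finset.mem_range] at hk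
    have h1 := norm_le_add_sum_Icc c (j := n + 1 + k) (N := N) (by lia) (by lia)
    have h2 := hc (n + 1 + k) (by lia)
    have h3 := norm_le_sum_range (c := c) hN₀ (n + 1 + k)
    have h4 : ‖c N‖ ≤ (1 + M) * ∑ i ∈ Finset.range N₀, ‖c (n + 1 + k + i)‖ := by linarith
    calc (k + 1 : ℝ)⁻¹ * ‖c N‖
        ≤ (k + 1 : ℝ)⁻¹ * ((1 + M) * ∑ i ∈ Finset.range N₀, ‖c (n + 1 + k + i)‖) :=
          mul_le_mul_of_nonneg_left h4 (by positivity)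
      _ = (1 + M) * ∑ i ∈ Finset.range N₀, (k + 1 : ℝ)⁻¹ * ‖c (n + 1 + k + i)‖ := by
          rw [← Finset.mul_sum]
          ring
      -- Shifting the weight costs N₀, because k+i+1 ≤ N₀(k+1) for i < N₀.
      _ ≤ (1 + M) * ∑ i ∈ Finset.range N₀, N₀ * u (k + i) := by
          refine mul_le_mul_of_nonneg_left (Finset.sum_le_sum fun i hi => ?_) (by positivity)
          have hi' : ((i + 1 : ℕ) : ℝ) ≤ N₀ := by exact_mod_cast Finset.mem_range.1 hi
          simp only [hu, ← mul_assoc, add_assoc]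
          refine mul_le_mul_of_nonneg_right ?_ (norm_nonneg _)
          rw [← div_eq_mul_inv, le_div_iff₀ (by positivity), inv_mul_le_iff₀ (by positivity)]
          push_cast at hi' ⊢
          have hk0 : (0 : ℝ) ≤ k := k.cast_nonneg
          nlinarith
      _ = _ := by
          rw [← Finset.mul_sum]
          ring
  -- Since N₀ ≤ n, the shifted indices stay below 2n.
  have hshift : ∀ i ∈ Finset.range N₀,
      ∑ k ∈ Finset.range n, u (k + i) ≤ ∑ k ∈ Finset.range (2 * n), u k := fun i hi => by
    rw [Finset.mem_range] at hi
    have h1 : ∑ k ∈ Finset.range n, u (k + i) = ∑ k ∈ Finset.Ico i (n + i), u k := by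
      rw [Finset.sum_Ico_eq_sum_range, add_tsub_cancel_right]
      simp only [add_comm]
    rw [h1]
    refine Finset.sum_le_sum_of_subset_of_nonneg (fun k hk => ?_) fun _ _ _ => hu0 _
    rw [Finset.mem_Ico] at hk
    rw [Finset.mem_range]
    lia
  have hsum : (∑ k ∈ Finset.range n, (k + 1 : ℝ)⁻¹) * ‖c N‖ ≤
      (1 + M) * N₀ ^ 2 * ∑ k ∈ Finset.range (2 * n), u k := by
    rw [Finset.sum_mul]
    refine (Finset.sum_le_sum hterm).trans ?_
    rw [← Finset.mul_sum, Finset.sum_comm]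
    calc (1 + M) * N₀ * ∑ i ∈ Finset.range N₀, ∑ k ∈ Finset.range n, u (k + i)
        ≤ (1 + M) * N₀ * ∑ i ∈ Finset.range N₀, ∑ k ∈ Finset.range (2 * n), u k :=
          mul_le_mul_of_nonneg_left (Finset.sum_le_sum hshift) (by positivity)
      _ = _ := by
          simp only [Finset.sum_const, Finset.card_range, nsmul_eq_mul]
          ring
  have hharm : Real.log (n + 1) ≤ ∑ k ∈ Finset.range n, (k + 1 : ℝ)⁻¹ := by
    have h := log_add_one_le_harmonic n
    simpa [harmonic] using h
  have hlog : Real.log N ≤ 2 * Real.log (n + 1) := by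
    have h1 : Real.log N ≤ Real.log (((n : ℝ) + 1) ^ 2) := by
      refine Real.log_le_log (by exact_mod_cast (by lia : 0 < N)) ?_
      have h2 : ((N : ℕ) : ℝ) ≤ ((2 * n + 1 : ℕ) : ℝ) := by exact_mod_cast (by lia : N ≤ 2 * n + 1)
      push_cast at h2
      nlinarith [sq_nonneg (n : ℝ)]
    rw [Real.log_pow] at h1
    exact_mod_cast h1
  calc ‖c N‖ * Real.log N ≤ ‖c N‖ * (2 * ∑ k ∈ Finset.range n, (k + 1 : ℝ)⁻¹) :=
        mul_le_mul_of_nonneg_left (by linarith) (norm_nonneg _)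
    _ = 2 * ((∑ k ∈ Finset.range n, (k + 1 : ℝ)⁻¹) * ‖c N‖) := by ring
    _ ≤ 2 * ((1 + M) * N₀ ^ 2 * ∑ k ∈ Finset.range (2 * n), u k) :=
        mul_le_mul_of_nonneg_left hsum (by norm_num)
    _ = _ := by ring

theorem IsGBV.norm_mul_log_le {c : ℕ → ℂ} (hc : IsGBV c) {ψ : ℕ → ℝ} {D K : ℝ} (hD : 0 < D)
    (hK : 0 < K) (hψ : ∀ n, 0 ≤ ψ n) (hdbl : ∀ m N, N ≤ 2 * m + 1 → ψ m ≤ K * ψ N)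
    (hsum : ∀ n, ‖∑ k ∈ Finset.range (2 * n), (((k + 1 : ℝ)⁻¹ : ℝ) : ℂ) * c (n + 1 + k)‖ ≤
      D * ψ n)
    (hle : ∀ n, ‖c (n + 1)‖ ≤ D * ψ n) :
    ∃ C : ℝ, 0 < C ∧ ∀ N : ℕ, 1 ≤ N → ‖c N‖ * Real.log N ≤ C * ψ N := by
  obtain ⟨⟨θ, hθ0, hθ, hsec⟩, N₀, hN₀, M, hM, hvar⟩ := hc
  have hcos : 0 < Real.cos θ := Real.cos_pos_of_mem_Ioo ⟨by linarith, hθ⟩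
  have hvar' : ∀ m : ℕ, 1 ≤ m → ∑ n ∈ Finset.Icc m (2 * m), ‖c n - c (n + 1)‖ ≤
      M * ∑ i ∈ Finset.range N₀, ‖c (m + i)‖ := fun m hm =>
    (hvar m hm).trans (mul_le_mul_of_nonneg_left (sup_nnnorm_Ico_le_sum c m N₀) hM.le)
  have hN₀' : (1 : ℝ) ≤ N₀ := by exact_mod_cast hN₀
  have hlog0 : 0 ≤ Real.log (2 * N₀) := Real.log_nonneg (by linarith)
  set A := 2 * (1 + M) * (N₀ : ℝ) ^ 2 * (Real.cos θ)⁻¹ with hA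
  have hA0 : 0 < A := by positivity
  refine ⟨(Real.log (2 * N₀) + A) * (D * K), by positivity, fun N hN => ?_⟩
  have hψN := hψ N
  rw [add_mul, add_mul]
  -- When N < 2N₀ the logarithm is at most log(2N₀), and the crude coefficient bound `hle` suffices.
  rcases le_or_gt N₀ (N / 2) with h | h
  · have h1 := norm_mul_log_le_sum hN₀ hM hvar' h
    have h2 := cos_mul_sum_norm_le hθ (Finset.range (2 * (N / 2))) (fun k => (k + 1 : ℝ)⁻¹)
      (fun k => c (N / 2 + 1 + k)) (fun k _ => by positivity) fun k _ => hsec _ (by lia)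
    have h3 := (h2.trans (hsum (N / 2))).trans
      (mul_le_mul_of_nonneg_left (hdbl (N / 2) N (by lia)) hD.le)
    rw [← le_inv_mul_iff₀ hcos] at h3
    have h4 := mul_le_mul_of_nonneg_left h3 (by positivity : 0 ≤ 2 * (1 + M) * (N₀ : ℝ) ^ 2)
    have h5 : 0 ≤ Real.log (2 * N₀) * (D * K) * ψ N := by positivity
    refine (h1.trans h4).trans ?_
    rw [hA]
    linarith
  · obtain ⟨n, rfl⟩ := Nat.exists_eq_add_of_le' hN
    have h1 := (hle n).trans (mul_le_mul_of_nonneg_left (hdbl n (n + 1) (by lia)) hD.le)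
    have h2 : Real.log ((n + 1 : ℕ) : ℝ) ≤ Real.log (2 * N₀) := by
      refine Real.log_le_log (by positivity) ?_
      exact_mod_cast (by lia : n + 1 ≤ 2 * N₀)
    have h3 := mul_le_mul h1 h2 (Real.log_natCast_nonneg _) (by positivity)
    have h5 : 0 ≤ A * (D * K) * ψ (n + 1) := by positivity
    linarith

theorem IsGBV.normL_expBlock_le {c : ℕ → ℂ} (hc : IsGBV c) {ψ : ℕ → ℝ} {C : ℝ} (hC : 0 < C)
    (hψ : Antitone ψ) (h : ∀ n : ℕ, 1 ≤ n → ‖c n‖ * Real.log n ≤ C * ψ n) :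
    ∃ B : ℝ, 0 < B ∧ ∀ n L : ℕ, 1 ≤ n → L ≤ n → normL (expBlock c n L) ≤ B * ψ n := by
  obtain ⟨-, N₀, hN₀, M, hM, hvar⟩ := hc
  have hN₀' : (1 : ℝ) ≤ N₀ := by exact_mod_cast hN₀
  have hpi := Real.pi_pos
  -- The last coefficient costs |c_{n+1}| plus one variation sum and the block's variation costs
  -- another, whence 1 + 2M.
  refine ⟨6 * (1 + Real.pi) * ((1 + 2 * M) * (N₀ * C)), by positivity, fun n L hn hL => ?_⟩
  have hlog : 0 ≤ Real.log ((n : ℝ) + 1) := Real.log_nonneg (by linarith [n.cast_nonneg (α := ℝ)])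
  have hvar' := (hvar (n + 1) (by lia)).trans
    (mul_le_mul_of_nonneg_left (sup_nnnorm_Ico_le_sum c (n + 1) N₀) hM.le)
  have h1 := norm_le_add_sum_Icc c (j := n + 1) (N := n + 1 + (L - 1)) (by lia) (by lia)
  have h2 : ∑ i ∈ Finset.range (L - 1), ‖c (n + 1 + i) - c (n + 1 + (i + 1))‖ ≤
      ∑ k ∈ Finset.Icc (n + 1) (2 * (n + 1)), ‖c k - c (k + 1)‖ := by
    have e : ∑ i ∈ Finset.range (L - 1), ‖c (n + 1 + i) - c (n + 1 + (i + 1))‖ =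
        ∑ k ∈ Finset.Ico (n + 1) (n + 1 + (L - 1)), ‖c k - c (k + 1)‖ := by
      rw [Finset.sum_Ico_eq_sum_range, add_tsub_cancel_left]
      rfl
    rw [e]
    refine Finset.sum_le_sum_of_subset_of_nonneg (fun k hk => ?_) fun _ _ _ => norm_nonneg _
    rw [Finset.mem_Ico] at hk
    rw [Finset.mem_Icc]
    lia
  have h3 := norm_le_sum_range (c := c) hN₀ (n + 1)
  have h4 : Real.log (n + 1) * ∑ i ∈ Finset.range N₀, ‖c (n + 1 + i)‖ ≤ N₀ * (C * ψ n) := by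
    rw [Finset.mul_sum]
    refine (Finset.sum_le_card_nsmul _ _ (C * ψ n) fun i _ => ?_).trans_eq (by simp)
    have h5 := h (n + 1 + i) (by lia)
    have h6 : Real.log ((n : ℝ) + 1) ≤ Real.log ((n + 1 + i : ℕ) : ℝ) := by
      refine Real.log_le_log (by positivity) ?_
      push_cast
      linarith [i.cast_nonneg (α := ℝ)]
    calc Real.log ((n : ℝ) + 1) * ‖c (n + 1 + i)‖
        ≤ ‖c (n + 1 + i)‖ * Real.log ((n + 1 + i : ℕ) : ℝ) := by
          rw [mul_comm]
          exact mul_le_mul_of_nonneg_left h6 (norm_nonneg _)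
      _ ≤ C * ψ (n + 1 + i) := h5
      _ ≤ C * ψ n := mul_le_mul_of_nonneg_left (hψ (by lia)) hC.le
  refine (_root_.normL_expBlock_le c hn hL).trans ?_
  calc _ ≤ 6 * (1 + Real.pi) * Real.log (n + 1) *
        ((1 + 2 * M) * ∑ i ∈ Finset.range N₀, ‖c (n + 1 + i)‖) :=
        mul_le_mul_of_nonneg_left (by linarith) (by positivity)
    _ = 6 * (1 + Real.pi) * ((1 + 2 * M) *
        (Real.log (n + 1) * ∑ i ∈ Finset.range N₀, ‖c (n + 1 + i)‖)) := by ring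
    _ ≤ 6 * (1 + Real.pi) * ((1 + 2 * M) * (N₀ * (C * ψ n))) := by gcongr
    _ = _ := by ring

/-! ### The rate of approximation -/

/-- The rate `(n+1)^{-r} ω(g, 1/(n+1))`. -/
noncomputable def jacksonRate (r : ℕ) (g : ℝ → ℂ) (n : ℕ) : ℝ :=
  ((n : ℝ) + 1) ^ (-(r : ℤ)) * modulusL g (((n : ℝ) + 1)⁻¹)

theorem jacksonRate_nonneg (r : ℕ) (g : ℝ → ℂ) (n : ℕ) : 0 ≤ jacksonRate r g n :=
  mul_nonneg (by positivity) (modulusL_nonneg _ _)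

theorem jacksonRate_antitone (r : ℕ) {g : ℝ → ℂ} (hg : PerInt g) :
    Antitone (jacksonRate r g) := fun m n hmn => by
  have hmn' : (m : ℝ) + 1 ≤ n + 1 := by exact_mod_cast Nat.succ_le_succ hmn
  have hm : (0 : ℝ) < (m : ℝ) + 1 := by positivity
  unfold jacksonRate
  refine mul_le_mul ?_ (modulusL_mono hg (inv_anti₀ hm hmn')) (modulusL_nonneg _ _) (by positivity)
  rw [zpow_neg, zpow_neg, zpow_natCast, zpow_natCast]
  exact inv_anti₀ (by positivity) (pow_le_pow_left₀ hm.le hmn' r)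

theorem jacksonRate_le_two_pow_mul (r : ℕ) {g : ℝ → ℂ} (hg : PerInt g) {m N : ℕ}
    (h : N ≤ 2 * m + 1) : jacksonRate r g m ≤ 2 ^ (r + 1) * jacksonRate r g N := by
  have h' : (N : ℝ) + 1 ≤ 2 * (m + 1) := by
    have : ((N + 1 : ℕ) : ℝ) ≤ ((2 * (m + 1) : ℕ) : ℝ) := by exact_mod_cast (by lia)
    push_cast at this
    exact this
  have hN : (0 : ℝ) < (N : ℝ) + 1 := by positivity
  have hm : (0 : ℝ) < (m : ℝ) + 1 := by positivity
  have h1 : ((m : ℝ) + 1)⁻¹ ≤ 2 * ((N : ℝ) + 1)⁻¹ := by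
    rw [← div_eq_mul_inv, inv_le_comm₀ hm (by positivity), inv_div, div_le_iff₀ (by norm_num)]
    linarith
  have h2 : modulusL g (((m : ℝ) + 1)⁻¹) ≤ 2 * modulusL g (((N : ℝ) + 1)⁻¹) := by
    have h3 := modulusL_nat_mul_le hg (((N : ℝ) + 1)⁻¹) 2
    push_cast at h3
    exact (modulusL_mono hg h1).trans h3
  have h4 : ((m : ℝ) + 1) ^ (-(r : ℤ)) ≤ 2 ^ r * ((N : ℝ) + 1) ^ (-(r : ℤ)) := by
    rw [zpow_neg, zpow_neg, zpow_natCast, zpow_natCast, ← inv_pow, ← inv_pow, ← mul_pow]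
    exact pow_le_pow_left₀ (by positivity) h1 r
  unfold jacksonRate
  calc _ ≤ (2 ^ r * ((N : ℝ) + 1) ^ (-(r : ℤ))) * (2 * modulusL g (((N : ℝ) + 1)⁻¹)) :=
        mul_le_mul h4 h2 (modulusL_nonneg _ _) (by positivity)
    _ = _ := by ring

/-! ### The two implications -/

theorem fhat_sub_partialSum {f : ℝ → ℂ} (hf : PerInt f) (n : ℕ) (k : ℤ) :
    fhat (fun x => f x - partialSum f n x) k = if |k| ≤ n then 0 else fhat f k := by
  rw [fhat_sub hf (perInt_partialSum f n)]
  have h := fhat_sum_expZ (Finset.Icc (-(n : ℤ)) n) (fhat f) k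
  rw [show fhat (partialSum f n) k = _ from h]
  simp only [Finset.mem_Icc, ← abs_le]
  split_ifs <;> simp

theorem norm_fhat_mul_log_le_of_normL_sub_partialSum_le {f : ℝ → ℂ} (hf : PerInt f)
    (hpos : IsGBV fun n : ℕ => fhat f (n : ℤ)) {ψ : ℕ → ℝ} {C K : ℝ} (hC : 0 < C) (hK : 0 < K)
    (hψ : ∀ n, 0 ≤ ψ n) (hdbl : ∀ m N, N ≤ 2 * m + 1 → ψ m ≤ K * ψ N)
    (h : ∀ n, normL (fun x => f x - partialSum f n x) ≤ C * ψ n) :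
    ∃ C' : ℝ, 0 < C' ∧ ∀ N : ℕ, 1 ≤ N → ‖fhat f N‖ * Real.log N ≤ C' * ψ N := by
  have hp : ∀ n, PerInt (fun x => f x - partialSum f n x) := fun n =>
    hf.sub (perInt_partialSum f n)
  have hhigh : ∀ n k : ℕ, fhat (fun x => f x - partialSum f n x) (n + 1 + k : ℕ) =
      fhat f (n + 1 + k : ℕ) := fun n k => by
    rw [fhat_sub_partialSum hf, if_neg]
    rw [Nat.abs_cast]
    lia
  refine hpos.norm_mul_log_le (D := 2 * C) (by positivity) hK hψ hdbl (fun n => ?_) fun n => ?_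
  · have h1 := norm_sum_fhat_div_le (hp n) (n := n) fun k hk => by
      rw [fhat_sub_partialSum hf, if_pos hk]
    simp only [hhigh] at h1
    refine h1.trans ?_
    linarith [h n]
  · have h1 := norm_fhat_le (hp n) ((n + 1 + 0 : ℕ) : ℤ)
    rw [hhigh] at h1
    have h2 := h n
    have h3 := mul_nonneg hC.le (hψ n)
    exact h1.trans (by linarith)

theorem partialSum_comp_neg (f : ℝ → ℂ) (n : ℕ) (x : ℝ) :
    partialSum (fun x => f (-x)) n x = partialSum f n (-x) := by
  simp only [partialSum_eq, fhat_comp_neg, expZ_apply_neg]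
  refine Finset.sum_nbij' (fun k => -k) (fun k => -k) ?_ ?_ ?_ ?_ ?_
  · intro k hk
    rw [Finset.mem_Icc] at hk ⊢
    lia
  · intro k hk
    rw [Finset.mem_Icc] at hk ⊢
    lia
  all_goals simp

/-- Degree zero is separate because the de la Vallée Poussin means need n ≥ 1. As T is constant, f -
S_0(f) is f - T minus its mean. -/
theorem normL_sub_partialSum_zero_le {f T : ℝ → ℂ} (hf : PerInt f) (hT : T ∈ trigPoly 0) :
    normL (fun x => f x - partialSum f 0 x) ≤ (1 + 2 * Real.pi) * normL (fun x => f x - T x) := by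
  have hTp := (perInt_and_continuous_of_mem_trigPoly hT).1
  have h0 : ∀ x, T x = fhat T 0 := fun x => by
    rw [← eq_sum_fhat_of_mem_trigPoly hT (s := {0}) (fun k hk => by simpa using hk) x]
    simp [expZ_zero]
  have h : (fun x => f x - partialSum f 0 x) =
      fun x => (f x - T x) - (fun _ => fhat (fun x => f x - T x) 0) x := by
    funext x
    rw [fhat_sub hf hTp, partialSum_eq, h0 x]
    simp [expZ_zero]
  have hc : normL (fun _ => fhat (fun x => f x - T x) 0) ≤
      2 * Real.pi * normL (fun x => f x - T x) := by
    have h1 := norm_fhat_le (hf.sub hTp) 0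
    have h2 : normL (fun _ => fhat (fun x => f x - T x) 0) =
        2 * Real.pi * ‖fhat (fun x => f x - T x) 0‖ := by
      simp only [normL, intervalIntegral.integral_const, smul_eq_mul]
      ring
    rw [h2]
    exact mul_le_mul_of_nonneg_left h1 (by positivity)
  rw [h]
  refine (normL_sub_le (hf.sub hTp)
    (PerInt.of_continuous (fun _ => rfl) continuous_const)).trans ?_
  linarith

theorem normL_sub_partialSum_le_of_norm_fhat_mul_log_le {f : ℝ → ℂ} (hf : PerInt f)
    (hpos : IsGBV fun n : ℕ => fhat f (n : ℤ)) (hneg : IsGBV fun n : ℕ => fhat f (-(n : ℤ)))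
    {ψ : ℕ → ℝ} {C J : ℝ} (hC : 0 < C) (hJ : 0 < J) (hψ : Antitone ψ) (hψ0 : ∀ n, 0 ≤ ψ n)
    (hjackson : ∀ n, ∃ T ∈ trigPoly n, normL (fun x => f x - T x) ≤ J * ψ n)
    (h1 : ∀ n : ℕ, 1 ≤ n → ‖fhat f n‖ * Real.log n ≤ C * ψ n)
    (h2 : ∀ n : ℕ, 1 ≤ n → ‖fhat f (-n)‖ * Real.log n ≤ C * ψ n) :
    ∃ C' : ℝ, 0 < C' ∧ ∀ n, normL (fun x => f x - partialSum f n x) ≤ C' * ψ n := by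
  obtain ⟨B₁, hB₁, H₁⟩ := hpos.normL_expBlock_le hC hψ h1
  obtain ⟨B₂, hB₂, H₂⟩ := hneg.normL_expBlock_le hC hψ h2
  have hpi := Real.pi_pos
  refine ⟨(3 + 2 * Real.pi) * J + 2 * (B₁ + B₂), by positivity, fun n => ?_⟩
  have hψn := hψ0 n
  have e1 := mul_nonneg hB₁.le hψn
  have e2 := mul_nonneg hB₂.le hψn
  have e3 := mul_nonneg hJ.le hψn
  have e4 := mul_nonneg hpi.le e3
  obtain ⟨T, hT, hTle⟩ := hjackson n
  rcases n.eq_zero_or_pos with rfl | hn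
  · refine (normL_sub_partialSum_zero_le hf hT).trans
      ((mul_le_mul_of_nonneg_left hTle (by positivity)).trans ?_)
    linarith
  · have h : (fun x => f x - partialSum f n x) =
        fun x => (f x - vpMean f n x) + (vpMean f n x - partialSum f n x) := by
      funext x
      ring
    have h3 := normL_sub_vpMean_le hf hn hT
    have h4 := normL_vpMean_sub_partialSum_le hn f (B := (B₁ + B₂) * ψ n)
      (fun L hL => (H₁ n L hn hL).trans (by linarith))
      (fun L hL => (H₂ n L hn hL).trans (by linarith))
    rw [h]
    refine (normL_add_le (hf.sub (perInt_vpMean f n))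
      ((perInt_vpMean f n).sub (perInt_partialSum f n))).trans ?_
    linarith

theorem norm_mul_log_abs_intCast (z : ℂ) (n : ℤ) :
    ‖z * ((Real.log |(n : ℝ)| : ℝ) : ℂ)‖ = ‖z‖ * Real.log (n.natAbs : ℝ) := by
  rw [norm_mul, Complex.norm_real, ← Int.cast_abs, Int.abs_eq_natAbs, Int.cast_natCast,
    Real.norm_of_nonneg (Real.log_natCast_nonneg _)]

theorem corollary3 (f : ℝ → ℂ) (hf : IsL2Pi f)
    (hpos : IsGBV fun n : ℕ => fhat f (n : ℤ))
    (hneg : IsGBV fun n : ℕ => fhat f (-(n : ℤ)))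
    (r : ℕ) (hr : 1 ≤ r) (hAC : ∀ k : ℕ, k < r → IsLocallyAC (iteratedDeriv k f)) :
    (∃ C : ℝ, 0 < C ∧ ∀ n : ℕ,
      normL (fun x => f x - partialSum f n x) ≤
        C * (((n : ℝ) + 1) ^ (-(r : ℤ)) * modulusL (iteratedDeriv r f) (((n : ℝ) + 1)⁻¹))) ↔
    (∃ C : ℝ, 0 < C ∧ ∀ n : ℤ, n ≠ 0 →
      ‖fhat f n * ((Real.log |(n : ℝ)| : ℝ) : ℂ)‖ ≤
        C * ((|(n : ℝ)| + 1) ^ (-(r : ℤ)) *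
          modulusL (iteratedDeriv r f) ((|(n : ℝ)| + 1)⁻¹))) := by
  -- Because r ≥ 1, f itself is continuous, hence measurable and integrable on every compact
  -- interval.
  have hf0 : IsLocallyAC f := by simpa using hAC 0 (by lia)
  have hfp : PerInt f := PerInt.of_continuous hf.1 hf0.continuous
  have hg : PerInt (iteratedDeriv r f) := perInt_iteratedDeriv hfp hAC
  set ψ := jacksonRate r (iteratedDeriv r f) with hψ
  have hψ0 : ∀ n, 0 ≤ ψ n := jacksonRate_nonneg r _
  have hdbl : ∀ m N, N ≤ 2 * m + 1 → ψ m ≤ 2 ^ (r + 1) * ψ N := fun m N h =>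
    jacksonRate_le_two_pow_mul r hg h
  have hrate : ∀ n : ℤ, (|(n : ℝ)| + 1) ^ (-(r : ℤ)) *
      modulusL (iteratedDeriv r f) ((|(n : ℝ)| + 1)⁻¹) = ψ n.natAbs := fun n => by
    rw [hψ, jacksonRate, ← Int.cast_abs, Int.abs_eq_natAbs, Int.cast_natCast]
  simp only [norm_mul_log_abs_intCast, hrate]
  change (∃ C : ℝ, 0 < C ∧ ∀ n : ℕ, normL (fun x => f x - partialSum f n x) ≤ C * ψ n) ↔ _
  constructor
  · rintro ⟨C, hC, h⟩
    obtain ⟨C₁, hC₁, H₁⟩ := norm_fhat_mul_log_le_of_normL_sub_partialSum_le hfp hpos hC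
      (by positivity) hψ0 hdbl h
    -- Reflection x ↦ -x swaps f̂(n) with f̂(-n) and preserves ‖f - S_n(f)‖; the rate ψ of the
    -- original f is kept.
    obtain ⟨C₂, hC₂, H₂⟩ := norm_fhat_mul_log_le_of_normL_sub_partialSum_le hfp.comp_neg
      (by simpa only [fhat_comp_neg] using hneg) hC (by positivity) hψ0 hdbl fun n => by
        simp only [partialSum_comp_neg]
        rw [normL_comp_neg fun x => f x - partialSum f n x]
        exact h n
    refine ⟨C₁ + C₂, by positivity, fun n hn => ?_⟩
    have hψn := hψ0 n.natAbs
    have e1 := mul_nonneg hC₁.le hψn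
    have e2 := mul_nonneg hC₂.le hψn
    rcases Int.natAbs_eq n with h' | h'
    · have h3 := H₁ n.natAbs (by lia)
      rw [← h'] at h3
      linarith
    · have h3 := H₂ n.natAbs (by lia)
      rw [fhat_comp_neg, ← h'] at h3
      linarith
  · rintro ⟨C, hC, h⟩
    obtain ⟨J, hJ, HJ⟩ := exists_trigPoly_normL_sub_le r
    refine normL_sub_partialSum_le_of_norm_fhat_mul_log_le hfp hpos hneg hC hJ
      (jacksonRate_antitone r hg) hψ0 (fun n => HJ f n hfp hAC) (fun n hn => ?_) fun n hn => ?_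
    · simpa using h n (by lia)
    · simpa using h (-n) (by lia)
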